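/- Let $d\ge 0$, $\alpha,\beta>0$ and $g\in L^2(\mathbb R^d)$. For $a,b>0$ let $\mathcal G(g,a,b)$ be the family of functions $t\mapsto e^{2\pi i\,bl\cdot t}g(t-ak)$, indexed by $(k,l)\in\mathbb Z^d\times\mathbb Z^d$. A family $(e_i)_{i\in I}$ in a Hilbert space $H$ is a Bessel sequence if $\sum_i|\langle f,e_i\rangle|^2\le B\|f\|^2$ for some $B>0$ and all $f\in H$; a frame if $A\|f\|^2\le\sum_i|\langle f,e_i\rangle|^2\le B\|f\|^2$ for some $A,B>0$ and all $f\in H$; a Riesz sequence if, for some $A,B>0$, the series $\sum_i c_ie_i$ converges unconditionally and $A\|c\|^2\le\|\sum_i c_ie_i\|^2\le B\|c\|^2$ for all $c\in\ell^2(I)$. If $\mathcal G(g,\alpha,\beta)=(g_\lambda)_\lambda$ is a Bessel sequence, a dual window for it is a function $\gamma\in L^2(\mathbb R^d)$ such that $\mathcal G(\gamma,\alpha,\beta)=(\gamma_\lambda)_\lambda$ is a Bessel sequence and $f=\sum_\lambda\langle f,g_\lambda\rangle\gamma_\lambda =\sum_\lambda\langle f,\gamma_\lambda\rangle g_\lambda$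 (unconditionally in $L^2$) for all $f\in L^2(\mathbb R^d)$. For $x\in\mathbb R^d$ define the pre-Gramian matrix $P(x)_{j,k}=\overline{g(x+\alpha j-k/\beta)}$, $j,k\in\mathbb Z^d$, and the Ron–Shen matrix $R(x)=P(x)^*P(x)$ with entries $R(x)_{k,l}=\sum_{j\in\mathbb Z^d}g(x+\alpha j-k/\beta)\,\overline{g(x+\alpha j-l/\beta)}$ (for a.e. $x$ these series converge absolutely). Theorem (Janssen, Ron–Shen). The following are equivalent. (i) $\mathcal G(g,\alpha,\beta)$ is a frame for $L^2(\mathbb R^d)$. (ii) $\mathcal G(g,\alpha,\beta)$ is a Bessel sequence and it has a dual window $\gamma\in L^2(\mathbb R^d)$ (so that $\mathcal G(\gamma,\alpha,\beta)$ is a Bessel sequence) satisfying Janssen's relation $$\sum_{j\in\mathbb Z^d}\gamma(x+\alpha j)\,\overline{g(x+\alpha j-k/\beta)}=\beta^d\delta_{k,0} \qquad\text{for all }k\in\mathbb Z^d\text{ and a.e. }x\in\mathbb R^d.$$ (ii') $\mathcal G(g,\alpha,\beta)$ is a Bessel sequence and there is $\gamma\in L^2(\mathbb R^d)$ such that $\mathcal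 G(\gamma,\alpha,\beta)$ is a Bessel sequence and Janssen's relation holds (the reconstruction formula is not demanded). (iii) $\mathcal G(g,1/\beta,1/\alpha)$ is a Riesz sequence in $L^2(\mathbb R^d)$. (iv) There are $A,B>0$ such that for almost every $x\in\mathbb R^d$ and all $c\in\ell^2(\mathbb Z^d)$ $$A\|c\|_2^2\le\sum_{j\in\mathbb Z^d}\Big|\sum_{k\in\mathbb Z^d}c_k\, \overline{g(x+\alpha j-k/\beta)}\Big|^2\le B\|c\|_2^2 ,$$ all the series being convergent. (v) There are $A,B>0$ such that for almost every $x\in\mathbb R^d$ the matrix $R(x)$ defines a bounded operator on $\ell^2(\mathbb Z^d)$ with spectrum $\sigma(R(x))\subseteq[A,B]$. (vi) There are constants $C,D$ such that for almost every $x\in\mathbb R^d$ the matrix $P(x)$ defines a bounded operator on $\ell^2(\mathbb Z^d)$ with $\|P(x)\|\le D$, and there is a bounded operator $\Gamma(x)$ on $\ell^2(\mathbb Z^d)$ with $\Gamma(x)P(x)=I$ and $\|\Gamma(x)\|\le C$. -/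

import Mathlib

open MeasureTheory
open scoped ENNReal ComplexConjugate

namespace Gabor

/-- `ℝ^d` with the Euclidean norm and Lebesgue measure. -/
abbrev Space (d : ℕ) : Type := EuclideanSpace ℝ (Fin d)

/-- The Hilbert space `L²(ℝ^d)`. -/
abbrev L2 (d : ℕ) : Type := Lp ℂ 2 (volume : Measure (Space d))

/-- The Hilbert space `ℓ²(I)`. -/
abbrev SeqL2 (I : Type*) : Type _ := lp (fun _ : I => ℂ) 2

/-- The point `a k ∈ ℝ^d` for `k ∈ ℤ^d`. -/
noncomputable def latticePoint {d : ℕ} (a : ℝ) (k : Fin d → ℤ) : Space d :=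
  WithLp.toLp 2 (fun i => a * (k i : ℝ))

/-- The function `t ↦ e^{2πi ξ·t} f(t - x)`. -/
noncomputable def tfShiftFun {d : ℕ} (x ξ : Space d) (f : Space d → ℂ) : Space d → ℂ :=
  fun t => Complex.exp (2 * Real.pi * Complex.I * ((inner ℝ ξ t : ℝ) : ℂ)) * f (t - x)

theorem memLp_tfShiftFun {d : ℕ} (x ξ : Space d) (f : L2 d) :
    MemLp (tfShiftFun x ξ f) 2 (volume : Measure (Space d)) := by
  have h1 : MemLp (fun t => f (t - x)) 2 (volume : Measure (Space d)) :=
    (Lp.memLp f).comp_measurePreserving (measurePreserving_sub_right volume x)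
  have hc : Continuous (fun t : Space d =>
      Complex.exp (2 * Real.pi * Complex.I * ((inner ℝ ξ t : ℝ) : ℂ))) := by
    fun_prop
  refine h1.of_le (hc.aestronglyMeasurable.mul h1.aestronglyMeasurable) ?_
  refine Filter.Eventually.of_forall fun t => ?_
  have : 2 * (Real.pi : ℂ) * Complex.I * ((inner ℝ ξ t : ℝ) : ℂ)
      = ((2 * Real.pi * inner ℝ ξ t : ℝ) : ℂ) * Complex.I := by
    push_cast; ring
  simp only [tfShiftFun, norm_mul, this, Complex.norm_exp_ofReal_mul_I, one_mul, le_refl]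

/-- The time-frequency shift `π(x, ξ) = M_ξ T_x` on `L²(ℝ^d)`. -/
noncomputable def tfShift {d : ℕ} (x ξ : Space d) (f : L2 d) : L2 d :=
  (memLp_tfShiftFun x ξ f).toLp (tfShiftFun x ξ f)

/-- The Gabor system `G(g, a, b)`: the time-frequency shifts of `g` along `aℤ^d × bℤ^d`,
indexed by `(k, l) ∈ ℤ^d × ℤ^d`. -/
noncomputable def system {d : ℕ} (g : L2 d) (a b : ℝ) (p : (Fin d → ℤ) × (Fin d → ℤ)) : L2 d :=
  tfShift (latticePoint a p.1) (latticePoint b p.2) g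

section Hilbert

variable {I H : Type*} [NormedAddCommGroup H] [InnerProductSpace ℂ H]

/-- Bessel sequence: `∑ |⟨f, e_i⟩|² ≤ B ‖f‖²` for all `f`. Mathlib's inner product is linear in
the second argument. -/
def IsBessel (e : I → H) : Prop :=
  ∃ B : ℝ, 0 < B ∧ ∀ f : H, Summable (fun i => ‖inner ℂ (e i) f‖ ^ 2) ∧
    ∑' i, ‖inner ℂ (e i) f‖ ^ 2 ≤ B * ‖f‖ ^ 2

/-- Frame: `A ‖f‖² ≤ ∑ |⟨f, e_i⟩|² ≤ B ‖f‖²` for all `f`. -/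
def IsFrame (e : I → H) : Prop :=
  ∃ A B : ℝ, 0 < A ∧ 0 < B ∧ ∀ f : H, Summable (fun i => ‖inner ℂ (e i) f‖ ^ 2) ∧
    A * ‖f‖ ^ 2 ≤ ∑' i, ‖inner ℂ (e i) f‖ ^ 2 ∧
    ∑' i, ‖inner ℂ (e i) f‖ ^ 2 ≤ B * ‖f‖ ^ 2

/-- Riesz sequence: `A ‖c‖² ≤ ‖∑ c_i e_i‖² ≤ B ‖c‖²` for all `c ∈ ℓ²(I)`. -/
def IsRieszSequence (e : I → H) : Prop :=
  ∃ A B : ℝ, 0 < A ∧ 0 < B ∧ ∀ c : SeqL2 I, Summable (fun i => c i • e i) ∧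
    A * ‖c‖ ^ 2 ≤ ‖∑' i, c i • e i‖ ^ 2 ∧
    ‖∑' i, c i • e i‖ ^ 2 ≤ B * ‖c‖ ^ 2

/-- `u` and `e` are dual to each other:
`f = ∑ ⟨f, e_i⟩ u_i = ∑ ⟨f, u_i⟩ e_i` for all `f`. -/
def Reconstructs (e u : I → H) : Prop :=
  ∀ f : H, HasSum (fun i => inner ℂ (e i) f • u i) f ∧ HasSum (fun i => inner ℂ (u i) f • e i) f

end Hilbert

/-- `γ` is a dual window for the Bessel sequence `G(g, a, b)`. -/
def IsDualWindow {d : ℕ} (g γ : L2 d) (a b : ℝ) : Prop :=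
  IsBessel (system γ a b) ∧ Reconstructs (system g a b) (system γ a b)

/-- Janssen's relation: `∑_j γ(x + αj) conj(g(x + αj - k/β)) = β^d δ_{k,0}` for all `k ∈ ℤ^d`
and almost every `x`. -/
def JanssenRelation {d : ℕ} (g γ : L2 d) (α β : ℝ) : Prop :=
  ∀ k : Fin d → ℤ, ∀ᵐ x : Space d,
    HasSum (fun j : Fin d → ℤ => γ (x + latticePoint α j) *
        conj (g (x + latticePoint α j - latticePoint (1 / β) k)))
      (if k = 0 then (β : ℂ) ^ d else 0)

/-- The pre-Gramian matrix `P(x)_{j,k} = conj(g(x + αj - k/β))`. -/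
noncomputable def preGramian {d : ℕ} (g : L2 d) (α β : ℝ) (x : Space d) (j k : Fin d → ℤ) : ℂ :=
  conj (g (x + latticePoint α j - latticePoint (1 / β) k))

/-- The Ron–Shen matrix `R(x) = P(x)* P(x)`. Its entries are sums of products of two
square-summable sequences for almost every `x`. -/
noncomputable def ronShen {d : ℕ} (g : L2 d) (α β : ℝ) (x : Space d) (k l : Fin d → ℤ) : ℂ :=
  ∑' j : Fin d → ℤ, conj (preGramian g α β x j k) * preGramian g α β x j l

/-- The bounded operator `T` on `ℓ²(I)` acts by the infinite matrix `M`: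
`(T c)_j = ∑_k M_{j,k} c_k`. -/
def ActsAs {I : Type*} (T : SeqL2 I →L[ℂ] SeqL2 I) (M : I → I → ℂ) : Prop :=
  ∀ (c : SeqL2 I) (j : I), HasSum (fun k => M j k * c k) (T c j)

/-- `A ‖c‖² ≤ ∑_j |∑_k M_{j,k} c_k|² ≤ B ‖c‖²` for all `c ∈ ℓ²(I)`, all series being
convergent. -/
def TwoSidedBounds {I : Type*} (M : I → I → ℂ) (A B : ℝ) : Prop :=
  ∀ c : SeqL2 I, (∀ j, Summable (fun k => c k * M j k)) ∧
    Summable (fun j => ‖∑' k, c k * M j k‖ ^ 2) ∧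
    A * ‖c‖ ^ 2 ≤ ∑' j, ‖∑' k, c k * M j k‖ ^ 2 ∧
    ∑' j, ‖∑' k, c k * M j k‖ ^ 2 ≤ B * ‖c‖ ^ 2

/-- The infinite matrix `M` defines a bounded operator on `ℓ²(I)` whose spectrum is contained in
the real interval `[A, B]`. -/
def SpectrumIn {I : Type*} (M : I → I → ℂ) (A B : ℝ) : Prop :=
  ∃ R : SeqL2 I →L[ℂ] SeqL2 I, ActsAs R M ∧
    spectrum ℂ R ⊆ (fun r : ℝ => (r : ℂ)) '' Set.Icc A B

end Gabor

/-! The pivot is the uniform two-sided bound for the pre-Gramians `P(x)`; every other condition is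
tied to it.

Frames. Modulations by `βℤ^d` have period `1/β`, so unfolding over a cube of side `1/β` and applying
Parseval there give `∑_p |⟨f, g_p⟩|² = β^{-d} ∫ ‖P(t) f_t‖² dt` with fibers `f_t = (f(t - k/β))_k`,
while `‖f‖² = ∫ ‖f_t‖² dt` (`HasFiniteFibers.tsum_enorm_sq_inner_system`). Frame bounds and
pointwise bounds for `P` thus agree up to the factor `β^d`.

Riesz sequences. Over the adjoint lattice the modulations have period `α`. Unfolding over a cube of
side `α` turns the squared norm of a finite combination into `∫ ‖P(t) m(t)‖² dt`, where the entries
of `m` are conjugated trigonometric polynomials (`enorm_sq_sum_system`); the same matrices control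
the Riesz bounds.

From integrals back to points, one tests with `c · 1_E`: step functions on the frame side, Fourier
coefficients of `1_E` on the Riesz side. A countable dense set of `c` makes the exceptional null set
independent of `c` (`ae_finiteBounds`).

Duality. The frame operator `S` commutes with the shifts of the lattice, so `S⁻¹ g` generates a dual
system. Testing reconstruction on step functions yields Janssen's relation
(`IsDualWindow.janssenRelation`), which says that `β^{-d} P_γ(x)* P_g(x) = I`. This bounded left
inverse gives the lower bound for `P_g(x)`. The Ron–Shen condition is equivalent because the
quadratic form of `P* P` is `‖P c‖²`. -/

namespace Gabor

/-! ### Characters, and cubes as fundamental domains of the lattice. -/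

section Lattice

variable {d : ℕ}

theorem latticePoint_apply (a : ℝ) (k : Fin d → ℤ) (i : Fin d) : latticePoint a k i = a * k i := rfl

theorem latticePoint_zero (a : ℝ) : latticePoint a (0 : Fin d → ℤ) = 0 := by
  ext i; simp [latticePoint_apply]

theorem latticePoint_add (a : ℝ) (k l : Fin d → ℤ) :
    latticePoint a (k + l) = latticePoint a k + latticePoint a l := by
  ext i; simp [latticePoint_apply, mul_add]

theorem latticePoint_neg (a : ℝ) (k : Fin d → ℤ) : latticePoint a (-k) = -latticePoint a k := by
  ext i; simp [latticePoint_apply]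

/-- The character `t ↦ e^{2πi ξ·t}`. -/
noncomputable def character (ξ t : Space d) : ℂ :=
  Complex.exp (2 * Real.pi * Complex.I * ((inner ℝ ξ t : ℝ) : ℂ))

theorem norm_character (ξ t : Space d) : ‖character ξ t‖ = 1 := by
  have : 2 * (Real.pi : ℂ) * Complex.I * ((inner ℝ ξ t : ℝ) : ℂ)
      = ((2 * Real.pi * inner ℝ ξ t : ℝ) : ℂ) * Complex.I := by
    push_cast; ring
  rw [character, this, Complex.norm_exp_ofReal_mul_I]

theorem continuous_character (ξ : Space d) : Continuous (character ξ) := by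
  unfold character; fun_prop

theorem character_add_right (ξ s t : Space d) :
    character ξ (s + t) = character ξ s * character ξ t := by
  rw [character, character, character, ← Complex.exp_add, inner_add_right]
  push_cast; ring_nf

theorem character_add_left (ξ η t : Space d) :
    character (ξ + η) t = character ξ t * character η t := by
  rw [character, character, character, ← Complex.exp_add, inner_add_left]
  push_cast; ring_nf

theorem character_zero_left (t : Space d) : character 0 t = 1 := by
  simp [character]

theorem conj_character (ξ t : Space d) : conj (character ξ t) = character (-ξ) t := by
  rw [character, character, ← Complex.exp_conj]
  simp [Complex.conj_ofReal, Complex.conj_ofNat]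

theorem conj_character_mul_self (ξ t : Space d) : conj (character ξ t) * character ξ t = 1 := by
  rw [conj_character, ← character_add_left, neg_add_cancel, character_zero_left]

theorem character_latticePoint_self {a b : ℝ} (hab : a * b = 1) (l k : Fin d → ℤ) :
    character (latticePoint b l) (latticePoint a k) = 1 := by
  rw [character, Complex.exp_eq_one_iff]
  refine ⟨∑ i, l i * k i, ?_⟩
  have : inner ℝ (latticePoint b l) (latticePoint a k) = ((∑ i, l i * k i : ℤ) : ℝ) := by
    simp only [PiLp.inner_apply, latticePoint_apply, RCLike.inner_apply, conj_trivial]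
    push_cast
    refine Finset.sum_congr rfl fun i _ => ?_
    linear_combination (l i : ℝ) * k i * hab
  rw [this]
  push_cast; ring

theorem character_add_latticePoint {a b : ℝ} (hab : a * b = 1) (l k : Fin d → ℤ) (t : Space d) :
    character (latticePoint b l) (t + latticePoint a k) = character (latticePoint b l) t := by
  rw [character_add_right, character_latticePoint_self hab, mul_one]

/-- The half-open cube with corner `v` and side length `a`. -/
def cube (v : Space d) (a : ℝ) : Set (Space d) := {x | ∀ i, x i ∈ Set.Ioc (v i) (v i + a)}

theorem measurableSet_cube (v : Space d) (a : ℝ) : MeasurableSet (cube v a) := by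
  have : cube v a = ⋂ i, (fun x : Space d => x i) ⁻¹' Set.Ioc (v i) (v i + a) := by
    ext x; simp [cube]
  rw [this]
  exact MeasurableSet.iInter fun i => measurableSet_Ioc.preimage (by fun_prop)

theorem existsUnique_add_latticePoint_mem_cube {a : ℝ} (ha : 0 < a) (v x : Space d) :
    ∃! k : Fin d → ℤ, x + latticePoint a k ∈ cube v a := by
  have h := fun i => existsUnique_add_zsmul_mem_Ioc ha (x i) (v i)
  refine ⟨fun i => (h i).choose, fun i => ?_, fun k hk => funext fun i => ?_⟩
  · have := (h i).choose_spec.1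
    simpa [latticePoint_apply, mul_comm] using this
  · refine (h i).choose_spec.2 (k i) ?_
    have := hk i
    simpa [latticePoint_apply, mul_comm] using this

theorem eq_of_mem_cube {a : ℝ} (ha : 0 < a) {v x : Space d} {k l : Fin d → ℤ}
    (hk : x + latticePoint a k ∈ cube v a) (hl : x + latticePoint a l ∈ cube v a) : k = l :=
  (existsUnique_add_latticePoint_mem_cube ha v x).unique hk hl

theorem iUnion_preimage_cube {a : ℝ} (ha : 0 < a) (v : Space d) :
    ⋃ k : Fin d → ℤ, (fun x => x + latticePoint a k) ⁻¹' cube v a = Set.univ := by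
  refine Set.eq_univ_of_forall fun x => ?_
  obtain ⟨k, hk, -⟩ := existsUnique_add_latticePoint_mem_cube ha v x
  exact Set.mem_iUnion.2 ⟨k, hk⟩

theorem pairwise_disjoint_preimage_cube {a : ℝ} (ha : 0 < a) (v : Space d) :
    Pairwise (Function.onFun Disjoint
      fun k : Fin d → ℤ => (fun x => x + latticePoint a k) ⁻¹' cube v a) := by
  intro k l hkl
  refine Set.disjoint_left.2 fun x hk hl => hkl (eq_of_mem_cube ha hk hl)

theorem measurableSet_preimage_cube (a : ℝ) (v : Space d) (k : Fin d → ℤ) :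
    MeasurableSet ((fun x => x + latticePoint a k) ⁻¹' cube v a) :=
  (measurableSet_cube v a).preimage (by fun_prop)

theorem setLIntegral_preimage_cube (a : ℝ) (v : Space d) (k : Fin d → ℤ) (f : Space d → ℝ≥0∞) :
    ∫⁻ x in (fun x => x + latticePoint a k) ⁻¹' cube v a, f x
      = ∫⁻ x in cube v a, f (x - latticePoint a k) := by
  rw [← (measurePreserving_add_right volume (latticePoint a k)).setLIntegral_comp_preimage_emb
    (measurableEmbedding_addRight _) (fun x => f (x - latticePoint a k))]
  simp

/-- Unfolding: the lattice translates of a half-open cube partition the space exactly, with no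
boundary terms. -/
theorem lintegral_eq_tsum_cube {a : ℝ} (ha : 0 < a) (v : Space d) (f : Space d → ℝ≥0∞) :
    ∫⁻ x, f x = ∑' k : Fin d → ℤ, ∫⁻ x in cube v a, f (x - latticePoint a k) := by
  rw [← setLIntegral_univ, ← iUnion_preimage_cube ha v,
    lintegral_iUnion (measurableSet_preimage_cube a v) (pairwise_disjoint_preimage_cube ha v)]
  simp_rw [setLIntegral_preimage_cube]

theorem lintegral_eq_lintegral_cube {a : ℝ} (ha : 0 < a) (v : Space d) {f : Space d → ℝ≥0∞}
    (hf : Measurable f) :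
    ∫⁻ x, f x = ∫⁻ x in cube v a, ∑' k : Fin d → ℤ, f (x - latticePoint a k) := by
  rw [lintegral_eq_tsum_cube ha v, lintegral_tsum]
  exact fun k => (hf.comp (by fun_prop)).aemeasurable

theorem hasSum_integral_cube {a : ℝ} (ha : 0 < a) (v : Space d) {f : Space d → ℂ}
    (hf : Integrable f) :
    HasSum (fun k : Fin d → ℤ => ∫ x in cube v a, f (x - latticePoint a k)) (∫ x, f x) := by
  have := hasSum_integral_iUnion (f := f) (measurableSet_preimage_cube a v)
    (pairwise_disjoint_preimage_cube ha v) hf.integrableOn (μ := volume)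
  rw [iUnion_preimage_cube ha v, setIntegral_univ] at this
  refine this.congr_fun fun k => ?_
  rw [← (measurePreserving_add_right volume (latticePoint a k)).setIntegral_preimage_emb
    (measurableEmbedding_addRight _) (fun x => f (x - latticePoint a k))]
  simp

/-- Countably many cubes cover the space, so almost-everywhere claims reduce to one cube, where the
measure is finite and fibers are indexed without repetition. -/
theorem ae_of_forall_cube {a : ℝ} (ha : 0 < a) {p : Space d → Prop}
    (h : ∀ v : Space d, ∀ᵐ x ∂volume.restrict (cube v a), p x) : ∀ᵐ x, p x := by
  have hU : (⋃ k : Fin d → ℤ, cube (-latticePoint a k) a) = Set.univ := by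
    rw [← iUnion_preimage_cube ha (0 : Space d)]
    refine Set.iUnion_congr fun k => ?_
    ext x
    simp only [cube, Set.mem_ofPred_eq, Set.mem_preimage, PiLp.add_apply, PiLp.neg_apply,
      PiLp.zero_apply, Set.mem_Ioc]
    refine forall_congr' fun i => ?_
    constructor <;> rintro ⟨h1, h2⟩ <;> constructor <;> linarith
  rw [← Measure.restrict_univ (μ := (volume : Measure (Space d))), ← hU,
    ae_restrict_iUnion_eq]
  exact Filter.eventually_iSup.2 fun k => h _

theorem volume_cube_lt_top (v : Space d) (a : ℝ) : volume (cube v a) < ∞ := by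
  have hsub : cube v a ⊆ WithLp.toLp 2 '' Set.pi Set.univ (fun i => Set.Icc (v i) (v i + a)) := by
    intro x hx
    exact ⟨x.ofLp, fun i _ => ⟨(hx i).1.le, (hx i).2⟩, rfl⟩
  have hcomp : IsCompact (WithLp.toLp 2 '' Set.pi Set.univ (fun i => Set.Icc (v i) (v i + a))) :=
    (isCompact_univ_pi fun i => isCompact_Icc).image (PiLp.continuous_toLp 2 _)
  exact (measure_mono hsub).trans_lt hcomp.measure_lt_top

instance (v : Space d) (a : ℝ) : IsFiniteMeasure (volume.restrict (cube v a)) :=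
  ⟨by simpa using volume_cube_lt_top v a⟩

end Lattice

/-! ### Parseval's identity on a cube, transported from the unit torus. -/

section Torus

/-- The normalised Haar measure on the circle, as in Mathlib's Fourier analysis on `UnitAddTorus`. -/
noncomputable local instance : MeasureSpace UnitAddCircle := ⟨AddCircle.haarAddCircle⟩

local instance : IsProbabilityMeasure (volume : Measure UnitAddCircle) :=
  inferInstanceAs (IsProbabilityMeasure AddCircle.haarAddCircle)

variable {d : ℕ}

/-- The quotient map `ℝ^d → ℝ^d / (aℤ)^d`, normalised to the unit torus by `b = 1 / a`. -/
noncomputable def toTorus (b : ℝ) (t : Space d) : UnitAddTorus (Fin d) :=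
  fun i => ((b * t i : ℝ) : UnitAddCircle)

/-- The section of `toTorus` with values in a cube. -/
noncomputable def ofTorus (a b : ℝ) (v : Space d) (θ : UnitAddTorus (Fin d)) : Space d :=
  WithLp.toLp 2 (fun i => a * (AddCircle.equivIoc 1 (b * v i) (θ i) : ℝ))

theorem measurable_toTorus (b : ℝ) : Measurable (toTorus b : Space d → _) := by
  refine measurable_pi_lambda _ fun i => ?_
  exact AddCircle.measurable_mk'.comp (by fun_prop)

theorem measurable_ofTorus (a b : ℝ) (v : Space d) : Measurable (ofTorus a b v) := by
  refine (PiLp.continuous_toLp 2 _).measurable.comp (measurable_pi_lambda _ fun i => ?_)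
  refine Measurable.const_mul ?_ a
  exact measurable_subtype_coe.comp
    ((AddCircle.measurableEquivIoc 1 (b * v i)).measurable.comp (measurable_pi_apply i))

theorem ofTorus_toTorus {a b : ℝ} (hb : 0 < b) (hab : a * b = 1) {v t : Space d}
    (ht : t ∈ cube v a) : ofTorus a b v (toTorus b t) = t := by
  ext i
  have h1 : b * t i ∈ Set.Ioc (b * v i) (b * v i + 1) := by
    have := ht i
    constructor
    · exact mul_lt_mul_of_pos_left this.1 hb
    · calc b * t i ≤ b * (v i + a) := mul_le_mul_of_nonneg_left this.2 hb.le
        _ = _ := by linear_combination hab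
  change a * (AddCircle.equivIoc 1 (b * v i) ((b * t i : ℝ) : UnitAddCircle) : ℝ) = t i
  rw [AddCircle.equivIoc_coe_eq h1]
  linear_combination t i * hab

theorem mFourier_toTorus (b : ℝ) (l : Fin d → ℤ) (t : Space d) :
    UnitAddTorus.mFourier l (toTorus b t) = character (latticePoint b l) t := by
  simp only [UnitAddTorus.mFourier, ContinuousMap.coe_mk, toTorus, fourier_coe_apply, character]
  rw [← Complex.exp_sum]
  congr 1
  simp only [PiLp.inner_apply, latticePoint_apply, RCLike.inner_apply, conj_trivial]
  push_cast
  rw [Finset.mul_sum]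
  refine Finset.sum_congr rfl fun i _ => ?_
  simp; ring

/-- Scaling by `b` carries the cube to a unit cube, a fundamental domain of the torus; the Jacobian
is `b^{-d} = a^d`. -/
theorem lintegral_torus {a b : ℝ} (hb : 0 < b) (hab : a * b = 1) (v : Space d)
    (F : UnitAddTorus (Fin d) → ℝ≥0∞) :
    ∫⁻ t in cube v a, F (toTorus b t) = ENNReal.ofReal (a ^ d) * ∫⁻ θ, F θ := by
  have hbd : (0 : ℝ) < b ^ d := pow_pos hb d
  have habd : a ^ d * b ^ d = 1 := by rw [← mul_pow, hab, one_pow]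
  rw [UnitAddTorus.lintegral_preimage F (fun i => b * v i)]
  set U : Set (Fin d → ℝ) := {x | ∀ i, x i ∈ Set.Ioc (b * v i) (b * v i + 1)} with hU
  have hemb : MeasurableEmbedding (fun t : Space d => b • t.ofLp) :=
    (MeasurableEquiv.smul₀ b hb.ne').measurableEmbedding.comp
      (MeasurableEquiv.toLp 2 (Fin d → ℝ)).symm.measurableEmbedding
  have hmap : Measure.map (fun t : Space d => b • t.ofLp) volume
      = ENNReal.ofReal (a ^ d) • (volume : Measure (Fin d → ℝ)) := by
    have h1 : Measure.map (fun t : Space d => b • t.ofLp) volume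
        = Measure.map (fun y : Fin d → ℝ => b • y) (Measure.map WithLp.ofLp
          (volume : Measure (Space d))) := by
      rw [Measure.map_map (by fun_prop) (by fun_prop)]; rfl
    rw [h1, (PiLp.volume_preserving_ofLp (Fin d)).map_eq, Measure.map_addHaar_smul volume hb.ne']
    congr 2
    rw [Module.finrank_fin_fun, abs_of_pos (inv_pos.2 hbd)]
    exact (eq_inv_of_mul_eq_one_left habd).symm
  have hcube : cube v a = (fun t : Space d => b • t.ofLp) ⁻¹' U := by
    ext t
    refine forall_congr' fun i => ?_
    change _ ↔ b * t i ∈ _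
    constructor <;> rintro ⟨h1, h2⟩ <;> constructor <;> nlinarith
  calc ∫⁻ t in cube v a, F (toTorus b t)
      = ∫⁻ t in (fun t : Space d => b • t.ofLp) ⁻¹' U,
          (fun x : Fin d → ℝ => F (fun i => x i)) (b • t.ofLp) := by rw [hcube]; rfl
    _ = ∫⁻ x in U, F (fun i => x i) ∂(Measure.map (fun t : Space d => b • t.ofLp) volume) := by
        rw [hemb.restrict_map, hemb.lintegral_map]
    _ = _ := by rw [hmap, Measure.restrict_smul, lintegral_smul_measure, smul_eq_mul]

theorem map_toTorus {a b : ℝ} (hb : 0 < b) (hab : a * b = 1) (v : Space d) :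
    Measure.map (toTorus b) (volume.restrict (cube v a))
      = ENNReal.ofReal (a ^ d) • (volume : Measure (UnitAddTorus (Fin d))) := by
  refine Measure.ext_of_lintegral _ fun F hF => ?_
  rw [lintegral_map hF (measurable_toTorus b), lintegral_torus hb hab, lintegral_smul_measure,
    smul_eq_mul]

theorem integral_torus {a b : ℝ} (hb : 0 < b) (hab : a * b = 1) (v : Space d)
    {F : UnitAddTorus (Fin d) → ℂ} (hF : Measurable F) :
    ∫ t in cube v a, F (toTorus b t) = (a : ℂ) ^ d * ∫ θ, F θ := by
  have ha : 0 < a := by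
    by_contra h
    nlinarith
  rw [← integral_map (measurable_toTorus b).aemeasurable hF.aestronglyMeasurable,
    map_toTorus hb hab, integral_smul_measure, ENNReal.toReal_ofReal (pow_nonneg ha.le d)]
  simp [Complex.real_smul]

/-- `ofTorus` inverts `toTorus` on the cube, and the push-forward of Lebesgue measure is Haar
measure times the finite nonzero constant `a^d`, which does not affect integrability. -/
theorem memLp_comp_ofTorus {a b : ℝ} (hb : 0 < b) (hab : a * b = 1) {v : Space d}
    {H : Space d → ℂ} (hm : Measurable H) (hH : MemLp H 2 (volume.restrict (cube v a))) :
    MemLp (fun θ => H (ofTorus a b v θ)) 2 (volume : Measure (UnitAddTorus (Fin d))) := by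
  have ha : 0 < a := by
    by_contra h
    nlinarith
  have hm' : Measurable (fun θ => H (ofTorus a b v θ)) := hm.comp (measurable_ofTorus a b v)
  have h1 : MemLp (fun θ => H (ofTorus a b v θ)) 2
      (ENNReal.ofReal (a ^ d) • (volume : Measure (UnitAddTorus (Fin d)))) := by
    rw [← map_toTorus hb hab v, memLp_map_measure_iff hm'.aestronglyMeasurable
      (measurable_toTorus b).aemeasurable]
    refine hH.ae_eq ((ae_restrict_iff' (measurableSet_cube v a)).2 (.of_forall fun t ht => ?_))
    simp only [Function.comp_apply, ofTorus_toTorus hb hab ht]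
  have h0 : ENNReal.ofReal (a ^ d) ≠ 0 := by simpa using pow_pos ha d
  have h2 := h1.smul_measure (c := (ENNReal.ofReal (a ^ d))⁻¹) (ENNReal.inv_ne_top.2 h0)
  rwa [smul_smul, ENNReal.inv_mul_cancel h0 ENNReal.ofReal_ne_top, one_smul] at h2

/-- The `l`-th Fourier coefficient over a cube. -/
noncomputable def cubeCoeff (v : Space d) (a b : ℝ) (H : Space d → ℂ) (l : Fin d → ℤ) : ℂ :=
  ∫ t in cube v a, conj (character (latticePoint b l) t) * H t

theorem cubeCoeff_eq {a b : ℝ} (hb : 0 < b) (hab : a * b = 1) {v : Space d} {H : Space d → ℂ}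
    (hm : Measurable H) (l : Fin d → ℤ) :
    cubeCoeff v a b H l
      = (a : ℂ) ^ d * UnitAddTorus.mFourierCoeff (fun θ => H (ofTorus a b v θ)) l := by
  rw [UnitAddTorus.mFourierCoeff, ← integral_torus hb hab v, cubeCoeff]
  · refine setIntegral_congr_fun (measurableSet_cube v a) fun t ht => ?_
    simp only [ofTorus_toTorus hb hab ht, mFourier_toTorus, conj_character, latticePoint_neg,
      smul_eq_mul]
  · exact ((UnitAddTorus.mFourier (-l)).continuous.measurable).smul
      (hm.comp (measurable_ofTorus a b v))

/-- Parseval's identity over a cube. -/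
theorem hasSum_cubeCoeff {a b : ℝ} (hb : 0 < b) (hab : a * b = 1) {v : Space d}
    {H₁ H₂ : Space d → ℂ} (hm₁ : Measurable H₁) (hm₂ : Measurable H₂)
    (h₁ : MemLp H₁ 2 (volume.restrict (cube v a)))
    (h₂ : MemLp H₂ 2 (volume.restrict (cube v a))) :
    HasSum (fun l => conj (cubeCoeff v a b H₂ l) * cubeCoeff v a b H₁ l)
      ((a : ℂ) ^ d * ∫ t in cube v a, conj (H₂ t) * H₁ t) := by
  have g₁ := memLp_comp_ofTorus hb hab hm₁ h₁
  have g₂ := memLp_comp_ofTorus hb hab hm₂ h₂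
  have key := UnitAddTorus.hasSum_prod_mFourierCoeff (g₂.toLp _) (g₁.toLp _)
  have hc : ∀ (F : UnitAddTorus (Fin d) → ℂ) (hF : MemLp F 2 volume) (l : Fin d → ℤ),
      UnitAddTorus.mFourierCoeff (hF.toLp F) l = UnitAddTorus.mFourierCoeff F l := by
    intro F hF l
    refine integral_congr_ae ?_
    filter_upwards [hF.coeFn_toLp] with θ hθ
    rw [hθ]
  have hi : ∫ θ, conj (g₂.toLp _ θ) * g₁.toLp _ θ
      = ∫ θ, conj (H₂ (ofTorus a b v θ)) * H₁ (ofTorus a b v θ) := by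
    refine integral_congr_ae ?_
    filter_upwards [g₁.coeFn_toLp, g₂.coeFn_toLp] with θ e₁ e₂
    rw [e₁, e₂]
  simp only [hc, hi] at key
  have hint : ∫ t in cube v a, conj (H₂ t) * H₁ t
      = (a : ℂ) ^ d * ∫ θ, conj (H₂ (ofTorus a b v θ)) * H₁ (ofTorus a b v θ) := by
    rw [← integral_torus hb hab v]
    · refine setIntegral_congr_fun (measurableSet_cube v a) fun t ht => ?_
      simp only [ofTorus_toTorus hb hab ht]
    · exact ((Complex.continuous_conj.measurable.comp hm₂).comp (measurable_ofTorus a b v)).mul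
        (hm₁.comp (measurable_ofTorus a b v))
  rw [hint, ← mul_assoc]
  -- Each of the two coefficients carries a factor `a^d`; one of these is absorbed by the integral
  -- over the cube, the other remains in front.
  refine (key.mul_left ((a : ℂ) ^ d * (a : ℂ) ^ d)).congr_fun fun l => ?_
  rw [cubeCoeff_eq hb hab hm₁, cubeCoeff_eq hb hab hm₂]
  simp only [map_mul, map_pow, Complex.conj_ofReal]
  ring

theorem cubeCoeff_character {a b : ℝ} (hb : 0 < b) (hab : a * b = 1) (v : Space d)
    (l m : Fin d → ℤ) :
    cubeCoeff v a b (character (latticePoint b m)) l = if l = m then (a : ℂ) ^ d else 0 := by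
  have h := orthonormal_iff_ite.1 (UnitAddTorus.orthonormal_mFourier (d := Fin d)) l m
  rw [ContinuousMap.inner_toLp] at h
  have : cubeCoeff v a b (character (latticePoint b m)) l
      = (a : ℂ) ^ d * ∫ θ, conj (UnitAddTorus.mFourier l θ) * UnitAddTorus.mFourier m θ := by
    rw [← integral_torus hb hab v]
    · simp only [mFourier_toTorus]; rfl
    · exact (Complex.continuous_conj.measurable.comp
        (UnitAddTorus.mFourier l).continuous.measurable).mul
        (UnitAddTorus.mFourier m).continuous.measurable
  simp_rw [mul_comm (conj _)] at this
  rw [this, h]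
  split_ifs <;> simp

end Torus

/-! ### Passage between extended and real-valued sums of squares, and the space `ℓ²`. -/

section Enorm

variable {I E : Type*} [SeminormedAddCommGroup E]

theorem enorm_sq_eq_ofReal (x : E) : ‖x‖ₑ ^ 2 = ENNReal.ofReal (‖x‖ ^ 2) := by
  rw [← ofReal_norm, ENNReal.ofReal_pow (norm_nonneg x)]

theorem tsum_enorm_sq {u : I → E} (hu : Summable fun i => ‖u i‖ ^ 2) :
    ∑' i, ‖u i‖ₑ ^ 2 = ENNReal.ofReal (∑' i, ‖u i‖ ^ 2) := by
  simp_rw [enorm_sq_eq_ofReal]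
  exact (ENNReal.ofReal_tsum_of_nonneg (fun _ => sq_nonneg _) hu).symm

theorem summable_norm_sq {u : I → E} (hu : ∑' i, ‖u i‖ₑ ^ 2 ≠ ∞) :
    Summable fun i => ‖u i‖ ^ 2 := by
  simp_rw [enorm_sq_eq_ofReal] at hu
  refine (ENNReal.summable_toReal hu).congr fun i => ?_
  rw [ENNReal.toReal_ofReal (sq_nonneg _)]

theorem sum_enorm_sq (K : Finset I) (u : I → E) :
    ∑ i ∈ K, ‖u i‖ₑ ^ 2 = ENNReal.ofReal (∑ i ∈ K, ‖u i‖ ^ 2) := by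
  simp_rw [enorm_sq_eq_ofReal]
  exact (ENNReal.ofReal_sum_of_nonneg fun _ _ => sq_nonneg _).symm

theorem ofReal_mul_ofReal_le_iff {A s t : ℝ} (hA : 0 ≤ A) (ht : 0 ≤ t) :
    ENNReal.ofReal A * ENNReal.ofReal s ≤ ENNReal.ofReal t ↔ A * s ≤ t := by
  rw [← ENNReal.ofReal_mul hA, ENNReal.ofReal_le_ofReal_iff ht]

theorem le_ofReal_mul_ofReal_iff {B s t : ℝ} (hB : 0 ≤ B) (hs : 0 ≤ s) :
    ENNReal.ofReal t ≤ ENNReal.ofReal B * ENNReal.ofReal s ↔ t ≤ B * s := by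
  rw [← ENNReal.ofReal_mul hB, ENNReal.ofReal_le_ofReal_iff (mul_nonneg hB hs)]

end Enorm

section SequenceSpace

variable {I : Type*}

theorem SeqL2.hasSum_norm_sq (c : SeqL2 I) : HasSum (fun i => ‖c i‖ ^ 2) (‖c‖ ^ 2) := by
  simpa using lp.hasSum_norm (p := 2) (by simp) c

theorem SeqL2.tsum_enorm_sq (c : SeqL2 I) : ∑' i, ‖c i‖ₑ ^ 2 = ‖c‖ₑ ^ 2 := by
  rw [Gabor.tsum_enorm_sq (SeqL2.hasSum_norm_sq c).summable, (SeqL2.hasSum_norm_sq c).tsum_eq,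
    enorm_sq_eq_ofReal]

theorem memℓp_two_of_summable {u : I → ℂ} (hu : Summable fun i => ‖u i‖ ^ 2) :
    Memℓp u 2 := memℓp_gen (by simpa using hu)

theorem SeqL2.norm_sq_sum_single [DecidableEq I] (K : Finset I) (c : I → ℂ) :
    ‖(∑ i ∈ K, lp.single 2 i (c i) : SeqL2 I)‖ ^ 2 = ∑ i ∈ K, ‖c i‖ ^ 2 := by
  simpa using lp.norm_sum_single (p := 2) (E := fun _ : I => ℂ) (by simp) c K

theorem SeqL2.sum_single_apply [DecidableEq I] (K : Finset I) (c : I → ℂ) (k : I) :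
    (∑ i ∈ K, lp.single 2 i (c i) : SeqL2 I) k = if k ∈ K then c k else 0 := by
  rw [lp.coeFn_sum, Finset.sum_apply]
  simp only [lp.single_apply, Pi.single_apply]
  rw [Finset.sum_ite_eq]

theorem SeqL2.single_eq_smul [DecidableEq I] (i : I) (z : ℂ) :
    (lp.single 2 i z : SeqL2 I) = z • lp.single 2 i 1 := by
  rw [← lp.single_smul]; simp

theorem SeqL2.hasSum_apply {ι : Type*} {u : ι → SeqL2 I} {s : SeqL2 I} (h : HasSum u s) (j : I) :
    HasSum (fun k => u k j) (s j) :=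
  h.mapL (lp.evalCLM ℂ (fun _ : I => ℂ) 2 j)

end SequenceSpace

/-! ### Bessel sequences, frames and synthesis operators in Hilbert space. -/

section Bessel

variable {I H : Type*} [NormedAddCommGroup H] [InnerProductSpace ℂ H]

theorem IsFrame.isBessel {e : I → H} (h : IsFrame e) : IsBessel e := by
  obtain ⟨A, B, -, hB, h⟩ := h
  exact ⟨B, hB, fun f => ⟨(h f).1, (h f).2.2⟩⟩

/-- Finite partial sums are continuous in `f`, so their bounds extend to the closure; the full sum
is their supremum. -/
theorem isBessel_of_forall_mem_dense {e : I → H} {D : Set H} (hD : Dense D) {B : ℝ} (hB : 0 < B)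
    (h : ∀ f ∈ D, ∑' i, ‖inner ℂ (e i) f‖ₑ ^ 2 ≤ ENNReal.ofReal B * ‖f‖ₑ ^ 2) : IsBessel e := by
  have hfin : ∀ (K : Finset I) (f : H), ∑ i ∈ K, ‖inner ℂ (e i) f‖ ^ 2 ≤ B * ‖f‖ ^ 2 := by
    intro K f
    have hc : IsClosed {f : H | ∑ i ∈ K, ‖inner ℂ (e i) f‖ ^ 2 ≤ B * ‖f‖ ^ 2} :=
      isClosed_le (by fun_prop) (by fun_prop)
    refine hc.closure_subset_iff.2 (fun f hf => ?_) (hD f)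
    have h1 := (ENNReal.sum_le_tsum K).trans (h f hf)
    rwa [sum_enorm_sq, enorm_sq_eq_ofReal, le_ofReal_mul_ofReal_iff hB.le (sq_nonneg _)] at h1
  refine ⟨B, hB, fun f => ?_⟩
  have hs := summable_of_sum_le (fun i => sq_nonneg ‖inner ℂ (e i) f‖) fun K => hfin K f
  exact ⟨hs, hs.tsum_le_of_sum_le fun K => hfin K f⟩

end Bessel

section Synthesis

variable {I H : Type*} [DecidableEq I] [NormedAddCommGroup H] [InnerProductSpace ℂ H]

/-- The bounded operator `T` on `ℓ²(I)` is the synthesis operator of the family `e`. -/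
def IsSynthesis (T : SeqL2 I →L[ℂ] H) (e : I → H) : Prop := ∀ i, T (lp.single 2 i 1) = e i

theorem IsSynthesis.hasSum {T : SeqL2 I →L[ℂ] H} {e : I → H} (hT : IsSynthesis T e)
    (c : SeqL2 I) : HasSum (fun i => c i • e i) (T c) := by
  refine ((lp.hasSum_single (p := 2) (by simp) c).mapL T).congr_fun fun i => ?_
  rw [SeqL2.single_eq_smul, map_smul, hT i]

/-- The adjoint is the analysis operator, so frame and Bessel bounds become norm bounds for `T*`. -/
theorem IsSynthesis.adjoint_apply [CompleteSpace H] {T : SeqL2 I →L[ℂ] H} {e : I → H}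
    (hT : IsSynthesis T e) (f : H) (i : I) :
    ContinuousLinearMap.adjoint T f i = inner ℂ (e i) f := by
  have h := ContinuousLinearMap.adjoint_inner_right T (lp.single 2 i 1) f
  rw [lp.inner_single_left, hT i] at h
  simpa using h

theorem IsSynthesis.hasSum_norm_sq_inner [CompleteSpace H] {T : SeqL2 I →L[ℂ] H} {e : I → H}
    (hT : IsSynthesis T e) (f : H) :
    HasSum (fun i => ‖inner ℂ (e i) f‖ ^ 2) (‖ContinuousLinearMap.adjoint T f‖ ^ 2) := by
  simpa only [hT.adjoint_apply] using SeqL2.hasSum_norm_sq (ContinuousLinearMap.adjoint T f)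

theorem IsSynthesis.le_norm_sq {T : SeqL2 I →L[ℂ] H} {e : I → H} (hT : IsSynthesis T e) {A : ℝ}
    (h : ∀ (K : Finset I) (c : I → ℂ), A * ∑ i ∈ K, ‖c i‖ ^ 2 ≤ ‖∑ i ∈ K, c i • e i‖ ^ 2)
    (c : SeqL2 I) : A * ‖c‖ ^ 2 ≤ ‖T c‖ ^ 2 := by
  refine le_of_tendsto_of_tendsto' (f := fun K : Finset I => A * ∑ i ∈ K, ‖c i‖ ^ 2)
    (g := fun K : Finset I => ‖∑ i ∈ K, c i • e i‖ ^ 2)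
    (Filter.Tendsto.const_mul _ (SeqL2.hasSum_norm_sq c)) ?_ fun K => h K c
  exact (Filter.Tendsto.norm (hT.hasSum c)).pow 2

theorem IsSynthesis.norm_sq_le {T : SeqL2 I →L[ℂ] H} {e : I → H} (hT : IsSynthesis T e) {B : ℝ}
    (h : ∀ (K : Finset I) (c : I → ℂ), ‖∑ i ∈ K, c i • e i‖ ^ 2 ≤ B * ∑ i ∈ K, ‖c i‖ ^ 2)
    (c : SeqL2 I) : ‖T c‖ ^ 2 ≤ B * ‖c‖ ^ 2 := by
  refine le_of_tendsto_of_tendsto' (g := fun K : Finset I => B * ∑ i ∈ K, ‖c i‖ ^ 2)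
    (f := fun K : Finset I => ‖∑ i ∈ K, c i • e i‖ ^ 2)
    ((hT.hasSum c).norm.pow 2) ?_ fun K => h K c
  exact Filter.Tendsto.const_mul _ (SeqL2.hasSum_norm_sq c)

variable [CompleteSpace H]

theorem exists_isSynthesis {e : I → H} {B : ℝ} (hB : 0 ≤ B)
    (h : ∀ (K : Finset I) (c : I → ℂ), ‖∑ i ∈ K, c i • e i‖ ^ 2 ≤ B * ∑ i ∈ K, ‖c i‖ ^ 2) :
    ∃ T : SeqL2 I →L[ℂ] H, IsSynthesis T e := by
  have hs : ∀ c : SeqL2 I, Summable fun i => c i • e i := by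
    intro c
    rw [summable_iff_vanishing_norm]
    intro ε hε
    -- Cauchy criterion: tails of `∑ c_i e_i` are controlled by tails of `∑ |c_i|²`. The denominator
    -- `B + 1` stays positive when `B = 0`.
    obtain ⟨s, hs⟩ := summable_iff_vanishing_norm.1 (SeqL2.hasSum_norm_sq c).summable
      (ε ^ 2 / (B + 1)) (by positivity)
    refine ⟨s, fun t ht => ?_⟩
    have h1 := hs t ht
    have h0 : 0 ≤ ∑ i ∈ t, ‖c i‖ ^ 2 := Finset.sum_nonneg fun _ _ => sq_nonneg _
    rw [Real.norm_of_nonneg h0, lt_div_iff₀ (by positivity)] at h1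
    have h2 := h t c
    refine lt_of_pow_lt_pow_left₀ 2 hε.le ?_
    nlinarith
  have hb : ∀ c : SeqL2 I, ‖∑' i, c i • e i‖ ^ 2 ≤ B * ‖c‖ ^ 2 := by
    intro c
    refine le_of_tendsto_of_tendsto' (g := fun K : Finset I => B * ∑ i ∈ K, ‖c i‖ ^ 2)
      (f := fun K : Finset I => ‖∑ i ∈ K, c i • e i‖ ^ 2)
      ((hs c).hasSum.norm.pow 2) ?_ fun K => h K c
    exact Filter.Tendsto.const_mul _ (SeqL2.hasSum_norm_sq c)
  let L : SeqL2 I →ₗ[ℂ] H :=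
    { toFun := fun c => ∑' i, c i • e i
      map_add' := fun c c' => by
        rw [← (hs c).tsum_add (hs c')]
        simp [add_smul]
      map_smul' := fun z c => by
        rw [RingHom.id_apply, ← (hs c).tsum_const_smul z]
        simp [mul_smul] }
  refine ⟨L.mkContinuous (Real.sqrt B) fun c => ?_, fun i => ?_⟩
  · refine le_of_sq_le_sq ?_ (by positivity)
    rw [mul_pow, Real.sq_sqrt hB]
    exact hb c
  · change ∑' j, (lp.single 2 i (1 : ℂ) : SeqL2 I) j • e j = e i
    rw [tsum_eq_single i]
    · simp
    · intro j hj
      simp [Pi.single_eq_of_ne hj]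

/-- Duality: for a finite sum `s`, Cauchy–Schwarz and the Bessel bound give `‖s‖⁴ ≤ ‖c‖² · B ‖s‖²`;
dividing by `‖s‖²` bounds synthesis by the same constant. -/
theorem IsBessel.exists_isSynthesis {e : I → H} (he : IsBessel e) :
    ∃ T : SeqL2 I →L[ℂ] H, IsSynthesis T e := by
  obtain ⟨B, hB, h⟩ := he
  refine Gabor.exists_isSynthesis hB.le fun K c => ?_
  set s := ∑ i ∈ K, c i • e i with hs
  have h1 : ‖s‖ ^ 2 ≤ ∑ i ∈ K, ‖c i‖ * ‖inner ℂ (e i) s‖ := by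
    have : ((‖s‖ ^ 2 : ℝ) : ℂ) = ∑ i ∈ K, c i * inner ℂ s (e i) := by
      calc ((‖s‖ ^ 2 : ℝ) : ℂ) = inner ℂ s s := by
            rw [inner_self_eq_norm_sq_to_K]; norm_cast
        _ = inner ℂ s (∑ i ∈ K, c i • e i) := by rw [← hs]
        _ = _ := by rw [inner_sum]; simp only [inner_smul_right]
    have h3 : ‖s‖ ^ 2 = ‖((‖s‖ ^ 2 : ℝ) : ℂ)‖ := by
      rw [Complex.norm_real, Real.norm_of_nonneg (sq_nonneg _)]
    rw [h3, this]
    refine (norm_sum_le _ _).trans (le_of_eq (Finset.sum_congr rfl fun i _ => ?_))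
    rw [norm_mul, norm_inner_symm]
  have h2 : (∑ i ∈ K, ‖c i‖ * ‖inner ℂ (e i) s‖) ^ 2
      ≤ (∑ i ∈ K, ‖c i‖ ^ 2) * ∑ i ∈ K, ‖inner ℂ (e i) s‖ ^ 2 :=
    Finset.sum_mul_sq_le_sq_mul_sq _ _ _
  have h3 : ∑ i ∈ K, ‖inner ℂ (e i) s‖ ^ 2 ≤ B * ‖s‖ ^ 2 :=
    ((h s).1.sum_le_tsum K fun _ _ => sq_nonneg _).trans (h s).2
  have h0 : 0 ≤ ∑ i ∈ K, ‖c i‖ ^ 2 := Finset.sum_nonneg fun _ _ => sq_nonneg _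
  rcases (norm_nonneg s).eq_or_lt' with hs0 | hs0
  · rw [hs0]; simp only [ne_eq, OfNat.ofNat_ne_zero, not_false_eq_true, zero_pow]; positivity
  · have h4 : (‖s‖ ^ 2) ^ 2 ≤ (∑ i ∈ K, ‖c i‖ ^ 2) * (B * ‖s‖ ^ 2) :=
      (pow_le_pow_left₀ (sq_nonneg _) h1 2).trans (h2.trans (mul_le_mul_of_nonneg_left h3 h0))
    have h5 : 0 < ‖s‖ ^ 2 := by positivity
    nlinarith

theorem IsSynthesis.isBessel {T : SeqL2 I →L[ℂ] H} {e : I → H} (hT : IsSynthesis T e) :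
    IsBessel e := by
  -- The summand `1` keeps the Bessel constant positive when `T = 0`.
  refine ⟨‖ContinuousLinearMap.adjoint T‖ ^ 2 + 1, by positivity, fun f => ?_⟩
  have h := hT.hasSum_norm_sq_inner f
  refine ⟨h.summable, ?_⟩
  rw [h.tsum_eq]
  have := pow_le_pow_left₀ (norm_nonneg _) ((ContinuousLinearMap.adjoint T).le_opNorm f) 2
  rw [mul_pow] at this
  nlinarith [sq_nonneg ‖f‖]

/-- A lower bound does not pass to the closure through partial sums. The upper bound comes first; it
makes `f ↦ ‖T* f‖²` continuous, and then both inequalities are closed conditions. -/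
theorem isFrame_of_forall_mem_dense {e : I → H} {D : Set H} (hD : Dense D) {A B : ℝ} (hA : 0 < A)
    (hB : 0 < B)
    (h : ∀ f ∈ D, ENNReal.ofReal A * ‖f‖ₑ ^ 2 ≤ ∑' i, ‖inner ℂ (e i) f‖ₑ ^ 2 ∧
      ∑' i, ‖inner ℂ (e i) f‖ₑ ^ 2 ≤ ENNReal.ofReal B * ‖f‖ₑ ^ 2) : IsFrame e := by
  obtain ⟨T, hT⟩ := (isBessel_of_forall_mem_dense hD hB fun f hf => (h f hf).2).exists_isSynthesis
  have hall : ∀ f : H, A * ‖f‖ ^ 2 ≤ ‖ContinuousLinearMap.adjoint T f‖ ^ 2 ∧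
      ‖ContinuousLinearMap.adjoint T f‖ ^ 2 ≤ B * ‖f‖ ^ 2 := by
    intro f
    have hc : IsClosed {f : H | A * ‖f‖ ^ 2 ≤ ‖ContinuousLinearMap.adjoint T f‖ ^ 2 ∧
        ‖ContinuousLinearMap.adjoint T f‖ ^ 2 ≤ B * ‖f‖ ^ 2} :=
      IsClosed.and (isClosed_le (by fun_prop) (by fun_prop)) (isClosed_le (by fun_prop) (by fun_prop))
    refine hc.closure_subset_iff.2 (fun f hf => ?_) (hD f)
    have h1 := h f hf
    have h2 := hT.hasSum_norm_sq_inner f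
    rw [tsum_enorm_sq h2.summable, h2.tsum_eq, enorm_sq_eq_ofReal,
      le_ofReal_mul_ofReal_iff hB.le (sq_nonneg _),
      ofReal_mul_ofReal_le_iff hA.le (sq_nonneg _)] at h1
    exact h1
  refine ⟨A, B, hA, hB, fun f => ?_⟩
  have h2 := hT.hasSum_norm_sq_inner f
  rw [h2.tsum_eq]
  exact ⟨h2.summable, hall f⟩

end Synthesis

/-! ### Spectrum and quadratic form of a self-adjoint operator. -/

section Spectrum

variable {H : Type*} [NormedAddCommGroup H] [InnerProductSpace ℂ H] [CompleteSpace H]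

theorem algebraMap_le_iff_forall {R : H →L[ℂ] H} (hR : IsSelfAdjoint R) (A : ℝ) :
    algebraMap ℝ (H →L[ℂ] H) A ≤ R ↔ ∀ c, A * ‖c‖ ^ 2 ≤ (inner ℂ (R c) c).re := by
  have hself : IsSelfAdjoint (R - algebraMap ℝ (H →L[ℂ] H) A) :=
    hR.sub ((IsSelfAdjoint.all A).algebraMap _)
  rw [ContinuousLinearMap.le_def, ContinuousLinearMap.isPositive_def']
  simp only [hself, true_and, ContinuousLinearMap.reApplyInnerSelf_apply]
  refine forall_congr' fun c => ?_
  have : inner ℂ ((R - algebraMap ℝ (H →L[ℂ] H) A) c) c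
      = inner ℂ (R c) c - ((A * ‖c‖ ^ 2 : ℝ) : ℂ) := by
    rw [Algebra.algebraMap_eq_smul_one]
    simp only [sub_apply, smul_apply, one_apply_eq_self, inner_sub_left]
    rw [← Complex.coe_smul, inner_smul_left, inner_self_eq_norm_sq_to_K]
    simp
  rw [this, RCLike.re_eq_complex_re, Complex.sub_re, Complex.ofReal_re, sub_nonneg]

theorem le_algebraMap_iff_forall {R : H →L[ℂ] H} (hR : IsSelfAdjoint R) (B : ℝ) :
    R ≤ algebraMap ℝ (H →L[ℂ] H) B ↔ ∀ c, (inner ℂ (R c) c).re ≤ B * ‖c‖ ^ 2 := by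
  rw [← neg_le_neg_iff, ← map_neg, algebraMap_le_iff_forall hR.neg]
  refine forall_congr' fun c => ?_
  rw [neg_apply, inner_neg_left, Complex.neg_re, neg_mul, neg_le_neg_iff]

/-- The spectrum of a self-adjoint operator lies in `[A, B]` iff its quadratic form is bounded by
`A` and `B`. -/
theorem spectrum_subset_Icc_iff {R : H →L[ℂ] H} (hR : IsSelfAdjoint R) {A B : ℝ} :
    spectrum ℂ R ⊆ (fun r : ℝ => (r : ℂ)) '' Set.Icc A B ↔
      ∀ c, A * ‖c‖ ^ 2 ≤ (inner ℂ (R c) c).re ∧ (inner ℂ (R c) c).re ≤ B * ‖c‖ ^ 2 := by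
  have h1 : spectrum ℂ R ⊆ (fun r : ℝ => (r : ℂ)) '' Set.Icc A B ↔
      ∀ x ∈ spectrum ℝ R, A ≤ x ∧ x ≤ B := by
    rw [← hR.spectrumRestricts.algebraMap_image, Set.image_subset_iff]
    constructor
    · intro h x hx
      obtain ⟨y, hy, hyx⟩ := h hx
      obtain rfl : y = x := Complex.ofReal_injective hyx
      exact hy
    · intro h x hx
      exact ⟨x, h x hx, rfl⟩
  rw [h1, forall_and, ← algebraMap_le_iff_forall hR, ← le_algebraMap_iff_forall hR,
    algebraMap_le_iff_le_spectrum (ha := hR), le_algebraMap_iff_spectrum_le (ha := hR)]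
  exact ⟨fun h => ⟨fun x hx => (h x hx).1, fun x hx => (h x hx).2⟩,
      fun h x hx => ⟨h.1 x hx, h.2 x hx⟩⟩

end Spectrum

/-! ### Infinite matrices on `ℓ²`: bounds, Gram matrices, left inverses. -/

section Matrix

variable {I : Type*}

/-- The energy `∑_j |∑_{k ∈ K} c_k M_{j,k}|²` of a finite combination of the columns of `M`. -/
noncomputable def colEnergy (M : I → I → ℂ) (K : Finset I) (c : I → ℂ) : ℝ≥0∞ :=
  ∑' j, ‖∑ k ∈ K, c k * M j k‖ₑ ^ 2

/-- Two-sided bounds for the finite combinations of the columns of `M`. -/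
def FiniteBounds (M : I → I → ℂ) (A B : ℝ) : Prop :=
  ∀ (K : Finset I) (c : I → ℂ),
    ENNReal.ofReal A * ∑ k ∈ K, ‖c k‖ₑ ^ 2 ≤ colEnergy M K c ∧
      colEnergy M K c ≤ ENNReal.ofReal B * ∑ k ∈ K, ‖c k‖ₑ ^ 2

/-- The Gram matrix `M* M` of the columns of `M`. -/
noncomputable def gram (M : I → I → ℂ) (k l : I) : ℂ := ∑' j, conj (M j k) * M j l

/-- The `k`-th column of `M` as an element of `ℓ²(I)`. -/
noncomputable def column {M : I → I → ℂ} (hM : ∀ k, Summable fun j => ‖M j k‖ ^ 2) (k : I) :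
    SeqL2 I := ⟨fun j => M j k, memℓp_two_of_summable (hM k)⟩

theorem sum_smul_column_apply {M : I → I → ℂ} (hM : ∀ k, Summable fun j => ‖M j k‖ ^ 2)
    (K : Finset I) (c : I → ℂ) (j : I) :
    (∑ k ∈ K, c k • column hM k) j = ∑ k ∈ K, c k * M j k := by
  rw [lp.coeFn_sum, Finset.sum_apply]
  rfl

theorem colEnergy_eq_enorm {M : I → I → ℂ} (hM : ∀ k, Summable fun j => ‖M j k‖ ^ 2)
    (K : Finset I) (c : I → ℂ) :
    colEnergy M K c = ‖∑ k ∈ K, c k • column hM k‖ₑ ^ 2 := by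
  rw [← SeqL2.tsum_enorm_sq]
  simp_rw [sum_smul_column_apply]
  rfl

theorem inner_column {M : I → I → ℂ} (hM : ∀ k, Summable fun j => ‖M j k‖ ^ 2) (k l : I) :
    inner ℂ (column hM k) (column hM l) = gram M k l := by
  rw [lp.inner_eq_tsum, gram]
  refine tsum_congr fun j => ?_
  rw [RCLike.inner_apply, mul_comm]
  rfl

theorem summable_column_of_colEnergy_le {M : I → I → ℂ} {B : ℝ}
    (h : ∀ (K : Finset I) (c : I → ℂ), colEnergy M K c ≤ ENNReal.ofReal B * ∑ k ∈ K, ‖c k‖ₑ ^ 2)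
    (k : I) : Summable fun j => ‖M j k‖ ^ 2 := by
  refine summable_norm_sq (ne_top_of_le_ne_top ?_ ((le_of_eq ?_).trans (h {k} 1)))
  · simp
  · simp [colEnergy]

variable [DecidableEq I]

theorem ActsAs.isSynthesis_column {M : I → I → ℂ} {T : SeqL2 I →L[ℂ] SeqL2 I} (hT : ActsAs T M)
    (k j : I) : T (lp.single 2 k 1) j = M j k := by
  refine (hT (lp.single 2 k 1) j).unique ?_
  convert hasSum_ite_eq k (M j k) using 2 with l
  rcases eq_or_ne l k with rfl | h
  · simp
  · simp [h]

theorem ActsAs.summable_column {M : I → I → ℂ} {T : SeqL2 I →L[ℂ] SeqL2 I} (hT : ActsAs T M)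
    (k : I) : Summable fun j => ‖M j k‖ ^ 2 := by
  simpa only [hT.isSynthesis_column] using (SeqL2.hasSum_norm_sq (T (lp.single 2 k 1))).summable

theorem ActsAs.isSynthesis {M : I → I → ℂ} {T : SeqL2 I →L[ℂ] SeqL2 I} (hT : ActsAs T M) :
    IsSynthesis T (column hT.summable_column) :=
  fun k => lp.ext (funext fun j => hT.isSynthesis_column k j)

theorem IsSynthesis.actsAs {M : I → I → ℂ} {hM : ∀ k, Summable fun j => ‖M j k‖ ^ 2}
    {T : SeqL2 I →L[ℂ] SeqL2 I} (hT : IsSynthesis T (column hM)) : ActsAs T M := by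
  intro c j
  refine (SeqL2.hasSum_apply (hT.hasSum c) j).congr_fun fun k => ?_
  rw [mul_comm]; rfl

theorem FiniteBounds.exists_actsAs {M : I → I → ℂ} {A B : ℝ} (hA : 0 ≤ A) (hB : 0 ≤ B)
    (h : FiniteBounds M A B) :
    ∃ T : SeqL2 I →L[ℂ] SeqL2 I, ActsAs T M ∧
      ∀ c, A * ‖c‖ ^ 2 ≤ ‖T c‖ ^ 2 ∧ ‖T c‖ ^ 2 ≤ B * ‖c‖ ^ 2 := by
  have hM := summable_column_of_colEnergy_le fun K c => (h K c).2
  have h' : ∀ (K : Finset I) (c : I → ℂ),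
      A * ∑ k ∈ K, ‖c k‖ ^ 2 ≤ ‖∑ k ∈ K, c k • column hM k‖ ^ 2 ∧
        ‖∑ k ∈ K, c k • column hM k‖ ^ 2 ≤ B * ∑ k ∈ K, ‖c k‖ ^ 2 := by
    intro K c
    have := h K c
    rwa [colEnergy_eq_enorm hM, sum_enorm_sq, enorm_sq_eq_ofReal,
      ofReal_mul_ofReal_le_iff hA (sq_nonneg _),
      le_ofReal_mul_ofReal_iff hB (Finset.sum_nonneg fun _ _ => sq_nonneg _)] at this
  obtain ⟨T, hT⟩ := exists_isSynthesis hB fun K c => (h' K c).2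
  exact ⟨T, hT.actsAs, fun c => ⟨hT.le_norm_sq (fun K c => (h' K c).1) c,
    hT.norm_sq_le (fun K c => (h' K c).2) c⟩⟩

omit [DecidableEq I] in
theorem ActsAs.twoSidedBounds {M : I → I → ℂ} {T : SeqL2 I →L[ℂ] SeqL2 I} (hT : ActsAs T M)
    {A B : ℝ} (h : ∀ c, A * ‖c‖ ^ 2 ≤ ‖T c‖ ^ 2 ∧ ‖T c‖ ^ 2 ≤ B * ‖c‖ ^ 2) :
    TwoSidedBounds M A B := by
  intro c
  have h1 : ∀ j, HasSum (fun k => c k * M j k) (T c j) := fun j => by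
    simpa only [mul_comm] using hT c j
  simp only [(h1 _).tsum_eq]
  have h2 := SeqL2.hasSum_norm_sq (T c)
  rw [h2.tsum_eq]
  exact ⟨fun j => (h1 j).summable, h2.summable, h c⟩

theorem TwoSidedBounds.finiteBounds {M : I → I → ℂ} {A B : ℝ} (hA : 0 ≤ A) (hB : 0 ≤ B)
    (h : TwoSidedBounds M A B) : FiniteBounds M A B := by
  intro K c
  obtain ⟨-, h2, h3⟩ := h (∑ k ∈ K, lp.single 2 k (c k))
  have h4 : ∀ j, ∑' k, (∑ k ∈ K, lp.single 2 k (c k) : SeqL2 I) k * M j k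
      = ∑ k ∈ K, c k * M j k := by
    intro j
    rw [tsum_eq_sum (s := K)]
    · exact Finset.sum_congr rfl fun k hkK => by rw [SeqL2.sum_single_apply, if_pos hkK]
    · intro k hkK
      rw [SeqL2.sum_single_apply, if_neg hkK, zero_mul]
  simp only [h4, SeqL2.norm_sq_sum_single] at h2 h3
  rw [colEnergy, tsum_enorm_sq h2, sum_enorm_sq, ofReal_mul_ofReal_le_iff hA
    (tsum_nonneg fun _ => sq_nonneg _), le_ofReal_mul_ofReal_iff hB
    (Finset.sum_nonneg fun _ _ => sq_nonneg _)]
  exact h3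

theorem FiniteBounds.twoSidedBounds {M : I → I → ℂ} {A B : ℝ} (hA : 0 ≤ A) (hB : 0 ≤ B)
    (h : FiniteBounds M A B) : TwoSidedBounds M A B := by
  obtain ⟨T, hT, hb⟩ := h.exists_actsAs hA hB
  exact hT.twoSidedBounds hb

/-- `T` synthesises from the columns of `M` and `T*` takes inner products with them, so `T* T` has
the Gram entries. -/
theorem ActsAs.actsAs_gram {M : I → I → ℂ} {T : SeqL2 I →L[ℂ] SeqL2 I} (hT : ActsAs T M) :
    ActsAs (ContinuousLinearMap.adjoint T ∘L T) (gram M) := by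
  intro c k
  have hs := hT.isSynthesis
  rw [ContinuousLinearMap.comp_apply, hs.adjoint_apply]
  refine ((hs.hasSum c).mapL (innerSL ℂ (column hT.summable_column k))).congr_fun fun l => ?_
  simp only [innerSL_apply_apply, inner_smul_right, inner_column]
  ring

theorem TwoSidedBounds.spectrumIn_gram {M : I → I → ℂ} {A B : ℝ} (hA : 0 ≤ A) (hB : 0 ≤ B)
    (h : TwoSidedBounds M A B) : SpectrumIn (gram M) A B := by
  obtain ⟨T, hT, hb⟩ := (h.finiteBounds hA hB).exists_actsAs hA hB
  refine ⟨_, hT.actsAs_gram, (spectrum_subset_Icc_iff ?_).2 fun c => ?_⟩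
  · exact (ContinuousLinearMap.isPositive_adjoint_comp_self T).isSelfAdjoint
  · have : (inner ℂ ((ContinuousLinearMap.adjoint T ∘L T) c) c).re = ‖T c‖ ^ 2 := by
      rw [ContinuousLinearMap.comp_apply, ContinuousLinearMap.adjoint_inner_left,
        inner_self_eq_norm_sq_to_K]
      norm_cast
    rw [this]
    exact hb c

/-- `M` is not known to be bounded, only to have square-summable columns. The Gram entries are
Hermitian, so `R` is self-adjoint and its spectrum bounds its quadratic form; on finite sequences
this form is the column energy, which bounds `M` in turn. -/
theorem SpectrumIn.twoSidedBounds {M : I → I → ℂ} {A B : ℝ} (hA : 0 ≤ A) (hB : 0 ≤ B)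
    (hM : ∀ k, Summable fun j => ‖M j k‖ ^ 2) (h : SpectrumIn (gram M) A B) :
    TwoSidedBounds M A B := by
  obtain ⟨R, hR, hs⟩ := h
  have hRs : ∀ k l, R (lp.single 2 k 1) l = gram M l k := hR.isSynthesis_column
  have hsymm : ∀ k l, conj (gram M k l) = gram M l k := fun k l => by
    rw [← inner_column hM, ← inner_column hM, inner_conj_symm]
  have hself : IsSelfAdjoint R := by
    rw [ContinuousLinearMap.isSelfAdjoint_iff']
    refine lp.ext_continuousLinearMap (by simp) fun k => ?_
    ext l
    simp only [ContinuousLinearMap.comp_apply, lp.singleContinuousLinearMap_apply]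
    have h1 := ContinuousLinearMap.adjoint_inner_right R (lp.single 2 l 1) (lp.single 2 k 1)
    rw [lp.inner_single_left, lp.inner_single_right, hRs] at h1
    simp only [RCLike.inner_apply, map_one, mul_one, one_mul] at h1
    rw [h1, hRs, hsymm]
  have hb := (spectrum_subset_Icc_iff hself).1 hs
  refine FiniteBounds.twoSidedBounds hA hB fun K c => ?_
  have key : (inner ℂ (R (∑ k ∈ K, lp.single 2 k (c k))) (∑ k ∈ K, lp.single 2 k (c k))).re
      = ‖∑ k ∈ K, c k • column hM k‖ ^ 2 := by
    rw [← inner_self_eq_norm_sq (𝕜 := ℂ), RCLike.re_eq_complex_re]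
    congr 1
    rw [map_sum, sum_inner, sum_inner]
    refine Finset.sum_congr rfl fun k _ => ?_
    rw [inner_sum, inner_sum]
    refine Finset.sum_congr rfl fun l _ => ?_
    rw [SeqL2.single_eq_smul k, SeqL2.single_eq_smul l, map_smul, inner_smul_left,
      inner_smul_left, inner_smul_right, inner_smul_right, inner_column, lp.inner_single_right, hRs]
    simp only [RCLike.inner_apply, one_mul, hsymm]
  have h1 := hb (∑ k ∈ K, lp.single 2 k (c k))
  rw [key, SeqL2.norm_sq_sum_single] at h1
  rwa [colEnergy_eq_enorm hM, sum_enorm_sq, enorm_sq_eq_ofReal,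
    ofReal_mul_ofReal_le_iff hA (sq_nonneg _),
    le_ofReal_mul_ofReal_iff hB (Finset.sum_nonneg fun _ _ => sq_nonneg _)]

omit [DecidableEq I] in
theorem ActsAs.twoSidedBounds_of_leftInverse {M : I → I → ℂ} {P G : SeqL2 I →L[ℂ] SeqL2 I}
    (hP : ActsAs P M) (hG : G ∘L P = ContinuousLinearMap.id ℂ _) {C D : ℝ} (hC : 0 < C)
    (hGn : ‖G‖ ≤ C) (hPn : ‖P‖ ≤ D) : TwoSidedBounds M (C ^ 2)⁻¹ (D ^ 2) := by
  refine hP.twoSidedBounds fun c => ⟨?_, ?_⟩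
  · rw [inv_mul_eq_div, div_le_iff₀ (by positivity), ← mul_pow]
    refine pow_le_pow_left₀ (norm_nonneg _) ?_ 2
    calc ‖c‖ = ‖G (P c)‖ := by rw [← ContinuousLinearMap.comp_apply, hG]; rfl
      _ ≤ ‖G‖ * ‖P c‖ := G.le_opNorm _
      _ ≤ ‖P c‖ * C := by rw [mul_comm]; exact mul_le_mul_of_nonneg_left hGn (norm_nonneg _)
  · rw [← mul_pow]
    exact pow_le_pow_left₀ (norm_nonneg _) (P.le_of_opNorm_le hPn c) 2

end Matrix

/-! ### From integrated bounds to bounds at almost every point. -/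

section Pointwise

variable {I : Type*}

theorem continuous_sum_enorm_sq (K : Finset I) :
    Continuous fun c : I → ℂ => ∑ k ∈ K, ‖c k‖ₑ ^ 2 :=
  continuous_finsetSum _ fun k _ => (ENNReal.continuous_pow 2).comp
    (continuous_enorm.comp (continuous_apply k))

/-- The upper bound closes up through partial sums over `j`. It puts the columns in `ℓ²`, so the
energy becomes the square of a norm, continuous in `c`, and the lower bound closes up too. -/
theorem finiteBounds_of_dense {M : I → I → ℂ} {A B : ℝ} {D : Set (I → ℂ)} (hD : Dense D)
    (h : ∀ K, ∀ c ∈ D, ENNReal.ofReal A * ∑ k ∈ K, ‖c k‖ₑ ^ 2 ≤ colEnergy M K c ∧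
      colEnergy M K c ≤ ENNReal.ofReal B * ∑ k ∈ K, ‖c k‖ₑ ^ 2) : FiniteBounds M A B := by
  have hu : ∀ (K : Finset I) (c : I → ℂ),
      colEnergy M K c ≤ ENNReal.ofReal B * ∑ k ∈ K, ‖c k‖ₑ ^ 2 := by
    intro K c
    rw [colEnergy, ENNReal.tsum_eq_iSup_sum, iSup_le_iff]
    intro J
    have hc : IsClosed {c : I → ℂ | ∑ j ∈ J, ‖∑ k ∈ K, c k * M j k‖ₑ ^ 2
        ≤ ENNReal.ofReal B * ∑ k ∈ K, ‖c k‖ₑ ^ 2} := by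
      refine isClosed_le ?_ ((ENNReal.continuous_const_mul ENNReal.ofReal_ne_top).comp
        (continuous_sum_enorm_sq K))
      exact continuous_finsetSum _ fun j _ => (ENNReal.continuous_pow 2).comp
        (continuous_enorm.comp (by fun_prop))
    exact hc.closure_subset_iff.2
      (fun c hc => (ENNReal.sum_le_tsum J).trans (h K c hc).2) (hD c)
  have hM := summable_column_of_colEnergy_le hu
  refine fun K c => ⟨?_, hu K c⟩
  simp only [colEnergy_eq_enorm hM] at h ⊢
  have hc : IsClosed {c : I → ℂ | ENNReal.ofReal A * ∑ k ∈ K, ‖c k‖ₑ ^ 2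
      ≤ ‖∑ k ∈ K, c k • column hM k‖ₑ ^ 2} := by
    refine isClosed_le ((ENNReal.continuous_const_mul ENNReal.ofReal_ne_top).comp
      (continuous_sum_enorm_sq K)) ?_
    exact (ENNReal.continuous_pow 2).comp (continuous_enorm.comp (by fun_prop))
  exact hc.closure_subset_iff.2 (fun c hc => (h K c hc).1) (hD c)

theorem measurable_colEnergy [Countable I] {X : Type*} [MeasurableSpace X] {M : X → I → I → ℂ}
    (hM : ∀ j k, Measurable fun x => M x j k) (K : Finset I) {c : X → I → ℂ}
    (hc : ∀ k, Measurable fun x => c x k) : Measurable fun x => colEnergy (M x) K (c x) := by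
  refine Measurable.tsum fun j => Measurable.pow_const (Measurable.enorm ?_) 2
  exact Finset.measurable_fun_sum _ fun k _ => (hc k).mul (hM j k)

/-- For fixed `K` and `c`, comparing integrals over all measurable sets gives the inequality off a
null set. There are countably many `K`, and a dense sequence of `c` suffices, so one null set serves
all. -/
theorem ae_finiteBounds [Countable I] {X : Type*} [MeasurableSpace X] {μ : Measure X}
    [SigmaFinite μ] {M : X → I → I → ℂ} (hM : ∀ j k, Measurable fun x => M x j k) {A B : ℝ}
    (h : ∀ (K : Finset I) (c : I → ℂ) (E : Set X), MeasurableSet E →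
      ENNReal.ofReal A * (∑ k ∈ K, ‖c k‖ₑ ^ 2) * μ E ≤ ∫⁻ x in E, colEnergy (M x) K c ∂μ ∧
      ∫⁻ x in E, colEnergy (M x) K c ∂μ ≤ ENNReal.ofReal B * (∑ k ∈ K, ‖c k‖ₑ ^ 2) * μ E) :
    ∀ᵐ x ∂μ, FiniteBounds (M x) A B := by
  have h1 : ∀ (K : Finset I) (n : ℕ), ∀ᵐ x ∂μ,
      ENNReal.ofReal A * ∑ k ∈ K, ‖TopologicalSpace.denseSeq (I → ℂ) n k‖ₑ ^ 2
        ≤ colEnergy (M x) K (TopologicalSpace.denseSeq (I → ℂ) n) ∧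
      colEnergy (M x) K (TopologicalSpace.denseSeq (I → ℂ) n)
        ≤ ENNReal.ofReal B * ∑ k ∈ K, ‖TopologicalSpace.denseSeq (I → ℂ) n k‖ₑ ^ 2 := by
    intro K n
    have hm := measurable_colEnergy hM K (c := fun _ => TopologicalSpace.denseSeq (I → ℂ) n)
      fun k => measurable_const
    refine Filter.Eventually.and ?_ ?_
    · refine ae_le_of_forall_setLIntegral_le_of_sigmaFinite measurable_const fun E hE _ => ?_
      rw [setLIntegral_const]
      exact (h K _ E hE).1
    · refine ae_le_of_forall_setLIntegral_le_of_sigmaFinite hm fun E hE _ => ?_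
      rw [setLIntegral_const]
      exact (h K _ E hE).2
  have h2 := ae_all_iff.2 fun K => ae_all_iff.2 (h1 K)
  filter_upwards [h2] with x hx
  refine finiteBounds_of_dense (TopologicalSpace.denseRange_denseSeq (I → ℂ)) fun K c hc => ?_
  obtain ⟨n, rfl⟩ := hc
  exact hx K n

end Pointwise

/-! ### Fiberization of the analysis operator. -/

section Fibers

variable {d : ℕ}

theorem tsum_enorm_sq_cubeCoeff {a b : ℝ} (hb : 0 < b) (hab : a * b = 1) {v : Space d}
    {H : Space d → ℂ} (hm : Measurable H) (hH : MemLp H 2 (volume.restrict (cube v a))) :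
    ∑' l, ‖cubeCoeff v a b H l‖ₑ ^ 2
      = ENNReal.ofReal (a ^ d) * ∫⁻ t in cube v a, ‖H t‖ₑ ^ 2 := by
  have ha : 0 < a := by
    by_contra h
    nlinarith
  have h1 := hasSum_cubeCoeff hb hab hm hm hH hH
  have hz : ∀ z : ℂ, conj z * z = ((‖z‖ ^ 2 : ℝ) : ℂ) := fun z => by
    rw [mul_comm, Complex.mul_conj, Complex.normSq_eq_norm_sq]
  have hsq : Integrable (fun t => ‖H t‖ ^ 2) (volume.restrict (cube v a)) := hH.integrable_norm_pow two_ne_zero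
  simp only [hz] at h1
  rw [integral_complex_ofReal, ← Complex.ofReal_pow, ← Complex.ofReal_mul,
    Complex.hasSum_ofReal] at h1
  rw [tsum_enorm_sq h1.summable, h1.tsum_eq, ENNReal.ofReal_mul (pow_nonneg ha.le d),
    ofReal_integral_eq_lintegral_ofReal hsq (.of_forall fun _ => sq_nonneg _)]
  simp_rw [enorm_sq_eq_ofReal]

theorem measurable_coe_L2 (g : L2 d) : Measurable (g : Space d → ℂ) :=
  (Lp.stronglyMeasurable g).measurable

theorem memLp_comp_sub (g : L2 d) (x : Space d) : MemLp (fun t => g (t - x)) 2 volume :=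
  (Lp.memLp g).comp_measurePreserving (measurePreserving_sub_right volume x)

theorem L2.enorm_sq_eq_lintegral {f : L2 d} {F : Space d → ℂ} (hF : f =ᵐ[volume] F) :
    ‖f‖ₑ ^ 2 = ∫⁻ t, ‖F t‖ₑ ^ 2 := by
  have := eLpNorm_nnreal_pow_eq_lintegral (μ := volume) (f := F) (p := 2) two_ne_zero
  rw [Lp.enorm_def, eLpNorm_congr_ae hF]
  simpa using this

theorem inner_system_eq_integral {g f : L2 d} {F : Space d → ℂ} (hF : f =ᵐ[volume] F) (s b : ℝ)
    (j l : Fin d → ℤ) :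
    inner ℂ (system g s b (j, l)) f
      = ∫ t, conj (character (latticePoint b l) t * g (t - latticePoint s j)) * F t := by
  rw [L2.inner_def]
  refine integral_congr_ae ?_
  filter_upwards [hF, (memLp_tfShiftFun (latticePoint s j) (latticePoint b l) g).coeFn_toLp]
    with t h1 h2
  rw [RCLike.inner_apply, h1, mul_comm, system, tfShift, h2]
  rfl

/-- A bounded measurable function whose fibers `(F (t - a k))_k`, `t` in the cube, are supported
in the finite set `K`. -/
structure HasFiniteFibers (F : Space d → ℂ) (v : Space d) (a : ℝ) (K : Finset (Fin d → ℤ)) :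
    Prop where
  measurable : Measurable F
  bounded : ∃ C : ℝ, ∀ t, ‖F t‖ ≤ C
  eq_zero : ∀ t ∈ cube v a, ∀ k ∉ K, F (t - latticePoint a k) = 0

/-- The function `t ↦ ∑_k F (t - a k) conj (g (t - a k - s j))`, the periodisation of the product of
`F` with the conjugate of a translate of `g`. -/
noncomputable def bracket (g F : Space d → ℂ) (s a : ℝ) (K : Finset (Fin d → ℤ))
    (j : Fin d → ℤ) (t : Space d) : ℂ :=
  ∑ k ∈ K, F (t - latticePoint a k) * conj (g (t - latticePoint a k - latticePoint s j))

theorem measurable_bracket {g F : Space d → ℂ} (hg : Measurable g) (hF : Measurable F) (s a : ℝ)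
    (K : Finset (Fin d → ℤ)) (j : Fin d → ℤ) : Measurable (bracket g F s a K j) := by
  refine Finset.measurable_fun_sum _ fun k _ => (hF.comp (by fun_prop)).mul ?_
  exact Complex.continuous_conj.measurable.comp (hg.comp (by fun_prop))

theorem HasFiniteFibers.memLp_bracket {F : Space d → ℂ} {v : Space d} {a : ℝ}
    {K : Finset (Fin d → ℤ)} (hF : HasFiniteFibers F v a K) (g : L2 d) (s : ℝ) (j : Fin d → ℤ) :
    MemLp (bracket g F s a K j) 2 (volume.restrict (cube v a)) := by
  obtain ⟨C, hC⟩ := hF.bounded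
  refine memLp_finsetSum K fun k _ => ?_
  have h1 : MemLp (fun t => g (t - (latticePoint a k + latticePoint s j))) 2
      (volume.restrict (cube v a)) := (memLp_comp_sub g _).restrict _
  refine h1.of_le_mul (c := C) ?_ (.of_forall fun t => ?_)
  · refine Measurable.aestronglyMeasurable ((hF.measurable.comp (by fun_prop)).mul ?_)
    exact Complex.continuous_conj.measurable.comp ((measurable_coe_L2 g).comp (by fun_prop))
  · rw [norm_mul, RCLike.norm_conj, sub_sub]
    exact mul_le_mul_of_nonneg_right (hC _) (norm_nonneg _)

/-- The character has period `a` because `a b = 1`, so it factors out of the unfolded integral and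
leaves a Fourier coefficient of the periodised product. Finite fibers make that periodisation a
finite sum. -/
theorem HasFiniteFibers.inner_system {F : Space d → ℂ} {v : Space d} {a b : ℝ} (hb : 0 < b)
    (hab : a * b = 1) {K : Finset (Fin d → ℤ)} (hF : HasFiniteFibers F v a K) {f : L2 d}
    (hf : f =ᵐ[volume] F) (g : L2 d) (s : ℝ) (j l : Fin d → ℤ) :
    inner ℂ (system g s b (j, l)) f = cubeCoeff v a b (bracket g F s a K j) l := by
  have ha : 0 < a := by
    by_contra h
    nlinarith
  have hFL : MemLp F 2 volume := (Lp.memLp f).ae_eq hf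
  have hgL := memLp_tfShiftFun (latticePoint s j) (latticePoint b l) g
  set h : Space d → ℂ := fun t =>
    conj (character (latticePoint b l) t * g (t - latticePoint s j)) * F t with hh
  have hint : Integrable h := MemLp.integrable_mul (p := 2) (q := 2) hgL.star hFL
  have hper : ∀ t k, h (t - latticePoint a k) = conj (character (latticePoint b l) t) *
      (F (t - latticePoint a k) * conj (g (t - latticePoint a k - latticePoint s j))) := by
    intro t k
    have := character_add_latticePoint hab l k (t - latticePoint a k)
    rw [sub_add_cancel] at this
    simp only [hh, map_mul, ← this]
    ring
  rw [inner_system_eq_integral hf]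
  change ∫ t, h t = _
  rw [← (hasSum_integral_cube ha v hint).tsum_eq, tsum_eq_sum (s := K)]
  · rw [← integral_finsetSum]
    · refine integral_congr_ae (.of_forall fun t => ?_)
      simp only [hper, bracket, Finset.mul_sum]
    · intro k _
      exact ((measurePreserving_sub_right volume (latticePoint a k)).integrable_comp_of_integrable
        hint).integrableOn
  · intro k hk
    refine (setIntegral_congr_fun (measurableSet_cube v a) fun t ht => ?_).trans (integral_zero _ ℂ)
    simp only [hper, hF.eq_zero t ht k hk, zero_mul, mul_zero]

theorem hasSum_inner_system {v : Space d} {a b : ℝ} (hb : 0 < b) (hab : a * b = 1)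
    {F₁ F₂ : Space d → ℂ} {K₁ K₂ : Finset (Fin d → ℤ)} (hF₁ : HasFiniteFibers F₁ v a K₁)
    (hF₂ : HasFiniteFibers F₂ v a K₂) {f₁ f₂ : L2 d} (hf₁ : f₁ =ᵐ[volume] F₁)
    (hf₂ : f₂ =ᵐ[volume] F₂) (g₁ g₂ : L2 d) (s : ℝ) (j : Fin d → ℤ) :
    HasSum (fun l => conj (inner ℂ (system g₂ s b (j, l)) f₂) * inner ℂ (system g₁ s b (j, l)) f₁)
      ((a : ℂ) ^ d * ∫ t in cube v a,
        conj (bracket g₂ F₂ s a K₂ j t) * bracket g₁ F₁ s a K₁ j t) := by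
  simp only [hF₁.inner_system hb hab hf₁, hF₂.inner_system hb hab hf₂]
  exact hasSum_cubeCoeff hb hab (measurable_bracket (measurable_coe_L2 g₁) hF₁.measurable _ _ _ _)
    (measurable_bracket (measurable_coe_L2 g₂) hF₂.measurable _ _ _ _)
    (hF₁.memLp_bracket g₁ s j) (hF₂.memLp_bracket g₂ s j)

theorem measurable_preGramian (g : L2 d) (α β : ℝ) (j k : Fin d → ℤ) :
    Measurable fun x => preGramian g α β x j k :=
  Complex.continuous_conj.measurable.comp ((measurable_coe_L2 g).comp (by fun_prop))

theorem bracket_neg (g : L2 d) (F : Space d → ℂ) (α β : ℝ) (K : Finset (Fin d → ℤ))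
    (j : Fin d → ℤ) (t : Space d) :
    bracket g F α (1 / β) K (-j) t
      = ∑ k ∈ K, F (t - latticePoint (1 / β) k) * preGramian g α β t j k := by
  refine Finset.sum_congr rfl fun k _ => ?_
  rw [preGramian, latticePoint_neg, sub_neg_eq_add, sub_add_eq_add_sub]

/-- The fiber formula for the analysis operator of a Gabor system. -/
theorem HasFiniteFibers.tsum_enorm_sq_inner_system {F : Space d → ℂ} {v : Space d} {α β : ℝ}
    (hβ : 0 < β) {K : Finset (Fin d → ℤ)} (hF : HasFiniteFibers F v (1 / β) K) {f : L2 d}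
    (hf : f =ᵐ[volume] F) (g : L2 d) :
    ∑' p, ‖inner ℂ (system g α β p) f‖ₑ ^ 2
      = ENNReal.ofReal ((1 / β) ^ d) * ∫⁻ t in cube v (1 / β),
          colEnergy (preGramian g α β t) K fun k => F (t - latticePoint (1 / β) k) := by
  have hab : 1 / β * β = 1 := by field_simp
  have hm := fun j => measurable_bracket (measurable_coe_L2 g) hF.measurable α (1 / β) K j
  -- The system translates by `-αj` whereas the rows of the pre-Gramian use `+αj`; hence the
  -- reindexing `j ↦ -j`.
  rw [ENNReal.tsum_prod (f := fun j l => ‖inner ℂ (system g α β (j, l)) f‖ₑ ^ 2),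
    ← (Equiv.neg (Fin d → ℤ)).tsum_eq]
  have h1 : ∀ j : Fin d → ℤ, ∑' l, ‖inner ℂ (system g α β (Equiv.neg _ j, l)) f‖ₑ ^ 2
      = ENNReal.ofReal ((1 / β) ^ d) * ∫⁻ t in cube v (1 / β),
        ‖∑ k ∈ K, F (t - latticePoint (1 / β) k) * preGramian g α β t j k‖ₑ ^ 2 := by
    intro j
    simp only [hF.inner_system hβ hab hf, Equiv.neg_apply]
    rw [tsum_enorm_sq_cubeCoeff hβ hab (hm _) (hF.memLp_bracket g α _)]
    simp only [bracket_neg]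
  simp only [h1]
  rw [ENNReal.tsum_mul_left, ← lintegral_tsum]
  · rfl
  · intro j
    have := (hm (-j)).enorm.pow_const 2
    simp only [bracket_neg] at this
    exact this.aemeasurable

theorem HasFiniteFibers.enorm_sq {F : Space d → ℂ} {v : Space d} {a : ℝ} (ha : 0 < a)
    {K : Finset (Fin d → ℤ)} (hF : HasFiniteFibers F v a K) {f : L2 d} (hf : f =ᵐ[volume] F) :
    ‖f‖ₑ ^ 2 = ∫⁻ t in cube v a, ∑ k ∈ K, ‖F (t - latticePoint a k)‖ₑ ^ 2 := by
  rw [L2.enorm_sq_eq_lintegral hf, lintegral_eq_lintegral_cube ha v (hF.measurable.enorm.pow_const 2)]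
  refine setLIntegral_congr_fun (measurableSet_cube v a) fun t ht => ?_
  refine tsum_eq_sum fun k hk => ?_
  rw [hF.eq_zero t ht k hk]; simp

end Fibers

/-! ### Step functions as test functions for the pre-Gramians. -/

section StepFunctions

variable {d : ℕ}

/-- The function with fibers `(c_k 1_E(t))_k`, for `t` in a cube of side `a` that contains `E`. -/
noncomputable def stepFun (E : Set (Space d)) (a : ℝ) (K : Finset (Fin d → ℤ))
    (c : (Fin d → ℤ) → ℂ) (s : Space d) : ℂ :=
  ∑ k ∈ K, c k * E.indicator 1 (s + latticePoint a k)

theorem measurable_stepFun {E : Set (Space d)} (hE : MeasurableSet E) (a : ℝ)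
    (K : Finset (Fin d → ℤ)) (c : (Fin d → ℤ) → ℂ) : Measurable (stepFun E a K c) := by
  refine Finset.measurable_fun_sum _ fun k _ => Measurable.const_mul ?_ _
  exact ((measurable_one).indicator hE).comp (by fun_prop)

theorem memLp_stepFun {E : Set (Space d)} (hE : MeasurableSet E) (hE' : volume E ≠ ∞) (a : ℝ)
    (K : Finset (Fin d → ℤ)) (c : (Fin d → ℤ) → ℂ) :
    MemLp (stepFun E a K c) 2 (volume : Measure (Space d)) := by
  refine memLp_finsetSum K fun k _ => MemLp.const_mul ?_ (c k)
  have h : MemLp (E.indicator (1 : Space d → ℂ)) 2 (volume : Measure (Space d)) :=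
    memLp_indicator_const 2 hE (1 : ℂ) (.inr hE')
  exact h.comp_measurePreserving (measurePreserving_add_right volume (latticePoint a k))

/-- Two distinct lattice translates of a point cannot both lie in the cube, so only one summand
survives. -/
theorem stepFun_sub {a : ℝ} (ha : 0 < a) {v : Space d} {E : Set (Space d)} (hE : E ⊆ cube v a)
    (K : Finset (Fin d → ℤ)) (c : (Fin d → ℤ) → ℂ) {t : Space d} (ht : t ∈ cube v a)
    (k : Fin d → ℤ) :
    stepFun E a K c (t - latticePoint a k) = if k ∈ K then c k * E.indicator 1 t else 0 := by
  have h1 : ∀ l, t - latticePoint a k + latticePoint a l = t + latticePoint a (l - k) := by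
    intro l
    rw [sub_eq_add_neg l k, latticePoint_add, latticePoint_neg]; abel
  have h2 : ∀ l, c l * E.indicator (1 : Space d → ℂ) (t - latticePoint a k + latticePoint a l)
      = if k = l then c k * E.indicator 1 t else 0 := by
    intro l
    split_ifs with h
    · rw [h, sub_add_cancel]
    · rw [Set.indicator_of_notMem, mul_zero]
      intro hl
      rw [h1] at hl
      have := eq_of_mem_cube ha (hE hl) (l := 0) (by simpa [latticePoint_zero] using ht)
      exact h (sub_eq_zero.1 this).symm
  simp only [stepFun, h2]
  rw [Finset.sum_ite_eq]

theorem hasFiniteFibers_stepFun {a : ℝ} (ha : 0 < a) {v : Space d} {E : Set (Space d)}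
    (hE : E ⊆ cube v a) (hEm : MeasurableSet E) (K : Finset (Fin d → ℤ))
    (c : (Fin d → ℤ) → ℂ) : HasFiniteFibers (stepFun E a K c) v a K where
  measurable := measurable_stepFun hEm a K c
  bounded := by
    refine ⟨∑ k ∈ K, ‖c k‖, fun t => (norm_sum_le _ _).trans (Finset.sum_le_sum fun k _ => ?_)⟩
    rw [norm_mul]
    refine mul_le_of_le_one_right (norm_nonneg _) ?_
    by_cases h : t + latticePoint a k ∈ E <;> simp [h]
  eq_zero := fun t ht k hk => by rw [stepFun_sub ha hE K c ht, if_neg hk]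

theorem setLIntegral_indicator_of_subset {E Q : Set (Space d)} (hEm : MeasurableSet E)
    (hE : E ⊆ Q) (φ : Space d → ℝ≥0∞) :
    ∫⁻ t in Q, E.indicator φ t = ∫⁻ t in E, φ t := by
  rw [setLIntegral_indicator hEm, Set.inter_eq_self_of_subset_left hE]

theorem enorm_sq_stepFun {a : ℝ} (ha : 0 < a) {v : Space d} {E : Set (Space d)}
    (hE : E ⊆ cube v a) (hEm : MeasurableSet E) (K : Finset (Fin d → ℤ))
    (c : (Fin d → ℤ) → ℂ) {f : L2 d} (hf : f =ᵐ[volume] stepFun E a K c) :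
    ‖f‖ₑ ^ 2 = (∑ k ∈ K, ‖c k‖ₑ ^ 2) * volume E := by
  rw [(hasFiniteFibers_stepFun ha hE hEm K c).enorm_sq ha hf, ← setLIntegral_const,
    ← setLIntegral_indicator_of_subset hEm hE]
  refine setLIntegral_congr_fun (measurableSet_cube v a) fun t ht => ?_
  by_cases h : t ∈ E
  · simp only [stepFun_sub ha hE K c ht, Set.indicator_of_mem h]
    exact Finset.sum_congr rfl fun k hk => by simp [hk]
  · simp only [stepFun_sub ha hE K c ht, Set.indicator_of_notMem h]
    exact Finset.sum_eq_zero fun k hk => by simp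

theorem tsum_enorm_sq_inner_system_stepFun {α β : ℝ} (hβ : 0 < β) {v : Space d} {E : Set (Space d)}
    (hE : E ⊆ cube v (1 / β)) (hEm : MeasurableSet E) (K : Finset (Fin d → ℤ))
    (c : (Fin d → ℤ) → ℂ) {f : L2 d} (hf : f =ᵐ[volume] stepFun E (1 / β) K c) (g : L2 d) :
    ∑' p, ‖inner ℂ (system g α β p) f‖ₑ ^ 2
      = ENNReal.ofReal ((1 / β) ^ d) * ∫⁻ t in E, colEnergy (preGramian g α β t) K c := by
  have ha : 0 < 1 / β := by positivity
  rw [(hasFiniteFibers_stepFun ha hE hEm K c).tsum_enorm_sq_inner_system hβ hf g,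
    ← setLIntegral_indicator_of_subset hEm hE]
  congr 1
  refine setLIntegral_congr_fun (measurableSet_cube v _) fun t ht => ?_
  by_cases h : t ∈ E
  · simp only [stepFun_sub ha hE K c ht, Set.indicator_of_mem h, colEnergy]
    refine tsum_congr fun j => ?_
    rw [Finset.sum_congr rfl fun k hk => by rw [if_pos hk, Pi.one_apply, mul_one]]
  · simp only [stepFun_sub ha hE K c ht, Set.indicator_of_notMem h, colEnergy]
    simp

/-- Bounds for the analysis operator of a Gabor system give bounds for almost all pre-Gramians. -/
theorem ae_finiteBounds_preGramian {g : L2 d} {α β A B : ℝ} (hβ : 0 < β) (hA : 0 ≤ A) (hB : 0 ≤ B)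
    (h : ∀ f : L2 d, ENNReal.ofReal A * ‖f‖ₑ ^ 2 ≤ ∑' p, ‖inner ℂ (system g α β p) f‖ₑ ^ 2 ∧
      ∑' p, ‖inner ℂ (system g α β p) f‖ₑ ^ 2 ≤ ENNReal.ofReal B * ‖f‖ₑ ^ 2) :
    ∀ᵐ x : Space d, FiniteBounds (preGramian g α β x) (A * β ^ d) (B * β ^ d) := by
  have ha : 0 < 1 / β := by positivity
  refine ae_of_forall_cube ha fun v => ae_finiteBounds (measurable_preGramian g α β) ?_
  intro K c E hE
  rw [Measure.restrict_restrict hE, Measure.restrict_apply hE]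
  have hEm := hE.inter (measurableSet_cube v (1 / β))
  have hsub : E ∩ cube v (1 / β) ⊆ cube v (1 / β) := Set.inter_subset_right
  have hfin : volume (E ∩ cube v (1 / β)) ≠ ∞ :=
    ((measure_mono hsub).trans_lt (volume_cube_lt_top v _)).ne
  set E' := E ∩ cube v (1 / β)
  have hL := memLp_stepFun hEm hfin (1 / β) K c
  have h1 := h (hL.toLp _)
  rw [tsum_enorm_sq_inner_system_stepFun hβ hsub hEm K c hL.coeFn_toLp,
    enorm_sq_stepFun ha hsub hEm K c hL.coeFn_toLp] at h1
  have hβd : ENNReal.ofReal (β ^ d) * ENNReal.ofReal ((1 / β) ^ d) = 1 := by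
    rw [← ENNReal.ofReal_mul (by positivity), ← mul_pow, mul_one_div_cancel hβ.ne', one_pow,
      ENNReal.ofReal_one]
  rw [ENNReal.ofReal_mul hA, ENNReal.ofReal_mul hB]
  set X := ∫⁻ t in E', colEnergy (preGramian g α β t) K c
  have hX : ENNReal.ofReal (β ^ d) * (ENNReal.ofReal ((1 / β) ^ d) * X) = X := by
    rw [← mul_assoc, hβd, one_mul]
  constructor
  · calc _ = ENNReal.ofReal (β ^ d) *
          (ENNReal.ofReal A * ((∑ k ∈ K, ‖c k‖ₑ ^ 2) * volume E')) := by ring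
      _ ≤ ENNReal.ofReal (β ^ d) * (ENNReal.ofReal ((1 / β) ^ d) * X) := mul_le_mul' le_rfl h1.1
      _ = X := hX
  · calc X = ENNReal.ofReal (β ^ d) * (ENNReal.ofReal ((1 / β) ^ d) * X) := hX.symm
      _ ≤ ENNReal.ofReal (β ^ d) *
          (ENNReal.ofReal B * ((∑ k ∈ K, ‖c k‖ₑ ^ 2) * volume E')) := mul_le_mul' le_rfl h1.2
      _ = _ := by ring

end StepFunctions

/-! ### Functions with finite fibers are dense; frame bounds and pointwise bounds. -/

section Density

variable {d : ℕ}

theorem exists_hasFiniteFibers_of_hasCompactSupport {F : Space d → ℂ} (hF : Continuous F)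
    (hc : HasCompactSupport F) (v : Space d) {a : ℝ} (ha : 0 < a) :
    ∃ K, HasFiniteFibers F v a K := by
  obtain ⟨R, hR⟩ := hc.isCompact.isBounded.subset_closedBall 0
  obtain ⟨C, hC⟩ := hF.bounded_above_of_compact_support hc
  -- If `t` is in the cube and `t - ak` in the ball of radius `R`, every coordinate satisfies `|a
  -- k_i| ≤ R + ‖v‖ + a`.
  obtain ⟨N, hN⟩ := exists_nat_gt ((R + ‖v‖ + a) / a)
  refine ⟨Fintype.piFinset fun _ => Finset.Icc (-(N : ℤ)) N, hF.measurable, ⟨C, hC⟩, ?_⟩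
  intro t ht k hk
  by_contra h0
  have hmem : t - latticePoint a k ∈ Metric.closedBall (0 : Space d) R :=
    hR (subset_tsupport F h0)
  rw [mem_closedBall_zero_iff] at hmem
  refine hk (Fintype.mem_piFinset.2 fun i => ?_)
  have h1 : |t i - a * k i| ≤ R := by
    have := PiLp.norm_apply_le (t - latticePoint a k) i
    simp only [PiLp.sub_apply, latticePoint_apply, Real.norm_eq_abs] at this
    exact this.trans hmem
  have h2 : |v i| ≤ ‖v‖ := PiLp.norm_apply_le v i
  have h3 := ht i
  rw [div_lt_iff₀ ha] at hN
  rw [abs_le] at h1 h2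
  have h4 : a * k i < a * N := by linarith [h3.1, h3.2]
  have h5 : a * (-N : ℝ) < a * k i := by linarith [h3.1, h3.2]
  have h6 := lt_of_mul_lt_mul_left h4 ha.le
  have h7 := lt_of_mul_lt_mul_left h5 ha.le
  rw [Finset.mem_Icc]
  have h8 : -(N : ℤ) < k i := by exact_mod_cast h7
  have h9 : k i < (N : ℤ) := by exact_mod_cast h6
  exact ⟨h8.le, h9.le⟩

theorem dense_hasFiniteFibers (v : Space d) {a : ℝ} (ha : 0 < a) :
    Dense {f : L2 d | ∃ F K, HasFiniteFibers F v a K ∧ f =ᵐ[volume] F} := by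
  intro f
  rw [Metric.mem_closure_iff]
  intro ε hε
  obtain ⟨F, hFc, hFε, hF, hFL⟩ := (Lp.memLp f).exists_hasCompactSupport_eLpNorm_sub_le
    (by simp) (ε := ENNReal.ofReal (ε / 2)) (by simpa using hε)
  obtain ⟨K, hK⟩ := exists_hasFiniteFibers_of_hasCompactSupport hF hFc v ha
  refine ⟨hFL.toLp F, ⟨F, K, hK, hFL.coeFn_toLp⟩, ?_⟩
  rw [Lp.dist_def]
  have : eLpNorm (⇑f - ⇑(hFL.toLp F)) 2 volume ≤ ENNReal.ofReal (ε / 2) := by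
    refine le_of_eq_of_le (eLpNorm_congr_ae ?_) hFε
    filter_upwards [hFL.coeFn_toLp] with t ht
    simp [ht]
  exact (ENNReal.toReal_le_of_le_ofReal (by positivity) this).trans_lt (by linarith)

/-- Bounds for almost all pre-Gramians give the frame property. -/
theorem isFrame_of_ae_finiteBounds {g : L2 d} {α β A B : ℝ} (hβ : 0 < β) (hA : 0 < A) (hB : 0 < B)
    (h : ∀ᵐ x : Space d, FiniteBounds (preGramian g α β x) A B) : IsFrame (system g α β) := by
  have ha : 0 < 1 / β := by positivity
  have had : 0 < (1 / β) ^ d := by positivity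
  refine isFrame_of_forall_mem_dense (dense_hasFiniteFibers 0 ha) (A := (1 / β) ^ d * A)
    (B := (1 / β) ^ d * B) (by positivity) (by positivity) ?_
  rintro f ⟨F, K, hF, hf⟩
  rw [hF.tsum_enorm_sq_inner_system hβ hf, hF.enorm_sq ha hf, ENNReal.ofReal_mul had.le,
    ENNReal.ofReal_mul had.le, mul_assoc, mul_assoc]
  have h' := ae_restrict_of_ae (s := cube 0 (1 / β)) h
  constructor
  · gcongr
    rw [← lintegral_const_mul' _ _ ENNReal.ofReal_ne_top]
    exact lintegral_mono_ae (h'.mono fun t ht => (ht K _).1)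
  · gcongr
    rw [← lintegral_const_mul' _ _ ENNReal.ofReal_ne_top]
    exact lintegral_mono_ae (h'.mono fun t ht => (ht K _).2)

theorem IsFrame.ae_twoSidedBounds {g : L2 d} {α β : ℝ} (hβ : 0 < β)
    (h : IsFrame (system g α β)) :
    ∃ A B : ℝ, 0 < A ∧ 0 < B ∧ ∀ᵐ x : Space d, TwoSidedBounds (preGramian g α β x) A B := by
  obtain ⟨A, B, hA, hB, h⟩ := h
  refine ⟨A * β ^ d, B * β ^ d, by positivity, by positivity, ?_⟩
  refine (ae_finiteBounds_preGramian hβ hA.le hB.le fun f => ?_).mono fun x hx =>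
    hx.twoSidedBounds (by positivity) (by positivity)
  rw [tsum_enorm_sq (h f).1, enorm_sq_eq_ofReal, ofReal_mul_ofReal_le_iff hA.le
    (tsum_nonneg fun _ => sq_nonneg _), le_ofReal_mul_ofReal_iff hB.le (sq_nonneg _)]
  exact (h f).2

/-- The lower constant `0` makes the lower inequality empty, so the two-sided machinery covers
Bessel sequences. -/
theorem IsBessel.ae_twoSidedBounds {g : L2 d} {α β : ℝ} (hβ : 0 < β)
    (h : IsBessel (system g α β)) :
    ∃ B : ℝ, 0 < B ∧ ∀ᵐ x : Space d, TwoSidedBounds (preGramian g α β x) 0 B := by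
  obtain ⟨B, hB, h⟩ := h
  refine ⟨B * β ^ d, by positivity, ?_⟩
  refine (ae_finiteBounds_preGramian hβ le_rfl hB.le fun f => ?_).mono fun x hx =>
    FiniteBounds.twoSidedBounds le_rfl (by positivity) (by simpa using hx)
  rw [tsum_enorm_sq (h f).1, enorm_sq_eq_ofReal, ofReal_mul_ofReal_le_iff le_rfl
    (tsum_nonneg fun _ => sq_nonneg _), le_ofReal_mul_ofReal_iff hB.le (sq_nonneg _), zero_mul]
  exact ⟨tsum_nonneg fun _ => sq_nonneg _, (h f).2⟩

end Density

/-! ### Trigonometric polynomials on a cube. -/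

section TrigonometricPolynomials

variable {d : ℕ}

theorem integrable_conj_character_mul_character (μ : Measure (Space d)) [IsFiniteMeasure μ]
    (ξ η : Space d) : Integrable (fun t => conj (character ξ t) * character η t) μ := by
  refine Integrable.of_bound (C := 1) (Continuous.aestronglyMeasurable ?_) (.of_forall fun t => ?_)
  · exact (Complex.continuous_conj.comp (continuous_character ξ)).mul (continuous_character η)
  · rw [norm_mul, RCLike.norm_conj, norm_character, norm_character, one_mul]

theorem continuous_sum_character (b : ℝ) (L : Finset (Fin d → ℤ)) (c : (Fin d → ℤ) → ℂ) :
    Continuous fun t => ∑ l ∈ L, c l * character (latticePoint b l) t :=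
  continuous_finsetSum _ fun _ _ => continuous_const.mul (continuous_character _)

theorem cubeCoeff_sum_character {a b : ℝ} (hb : 0 < b) (hab : a * b = 1) (v : Space d)
    (L : Finset (Fin d → ℤ)) (c : (Fin d → ℤ) → ℂ) (m : Fin d → ℤ) :
    cubeCoeff v a b (fun t => ∑ l ∈ L, c l * character (latticePoint b l) t) m
      = if m ∈ L then (a : ℂ) ^ d * c m else 0 := by
  have h : ∀ t, conj (character (latticePoint b m) t) *
      ∑ l ∈ L, c l * character (latticePoint b l) t
      = ∑ l ∈ L, c l * (conj (character (latticePoint b m) t) * character (latticePoint b l) t) := by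
    intro t
    rw [Finset.mul_sum]
    exact Finset.sum_congr rfl fun l _ => by ring
  simp only [cubeCoeff, h]
  rw [integral_finsetSum _ fun l _ =>
    (integrable_conj_character_mul_character _ _ _).const_mul _]
  simp only [integral_const_mul]
  have h2 : ∀ l, ∫ t in cube v a, conj (character (latticePoint b m) t) *
      character (latticePoint b l) t = if m = l then (a : ℂ) ^ d else 0 :=
    fun l => cubeCoeff_character hb hab v m l
  simp only [h2, mul_ite, mul_zero, Finset.sum_ite_eq, mul_comm (c m)]

theorem lintegral_enorm_sq_sum_character {a b : ℝ} (hb : 0 < b) (hab : a * b = 1) (v : Space d)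
    (L : Finset (Fin d → ℤ)) (c : (Fin d → ℤ) → ℂ) :
    ∫⁻ t in cube v a, ‖∑ l ∈ L, c l * character (latticePoint b l) t‖ₑ ^ 2
      = ENNReal.ofReal (a ^ d) * ∑ l ∈ L, ‖c l‖ₑ ^ 2 := by
  have ha : 0 < a := by
    by_contra h
    nlinarith
  have had : 0 < a ^ d := pow_pos ha d
  have hcont := continuous_sum_character b L c
  have hmem : MemLp (fun t => ∑ l ∈ L, c l * character (latticePoint b l) t) 2
      (volume.restrict (cube v a)) := by
    refine MemLp.of_bound hcont.aestronglyMeasurable (∑ l ∈ L, ‖c l‖) (.of_forall fun t => ?_)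
    refine (norm_sum_le _ _).trans (le_of_eq (Finset.sum_congr rfl fun l _ => ?_))
    rw [norm_mul, norm_character, mul_one]
  have h := tsum_enorm_sq_cubeCoeff hb hab hcont.measurable hmem
  have hn : ‖(a : ℂ) ^ d‖ₑ = ENNReal.ofReal (a ^ d) := by
    rw [← ofReal_norm, norm_pow, Complex.norm_real, Real.norm_of_nonneg ha.le]
  have h2 : ∑' l, ‖cubeCoeff v a b (fun t => ∑ l ∈ L, c l * character (latticePoint b l) t) l‖ₑ ^ 2
      = ENNReal.ofReal (a ^ d) * (ENNReal.ofReal (a ^ d) * ∑ l ∈ L, ‖c l‖ₑ ^ 2) := by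
    simp only [cubeCoeff_sum_character hb hab]
    rw [tsum_eq_sum (s := L) fun l hl => by simp [hl], Finset.mul_sum, Finset.mul_sum]
    refine Finset.sum_congr rfl fun l hl => ?_
    rw [if_pos hl, enorm_mul, hn]; ring
  rw [h2, ENNReal.mul_right_inj (by simpa using had) ENNReal.ofReal_ne_top] at h
  exact h.symm

end TrigonometricPolynomials

/-! ### Pointwise bounds imply the Riesz property over the adjoint lattice. -/

section Riesz

variable {d : ℕ}

theorem coeFn_system (g : L2 d) (a b : ℝ) (k l : Fin d → ℤ) :
    system g a b (k, l) =ᵐ[volume]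
      fun t => character (latticePoint b l) t * g (t - latticePoint a k) :=
  (memLp_tfShiftFun (latticePoint a k) (latticePoint b l) g).coeFn_toLp

theorem norm_sum_conj_mul_preGramian (g : L2 d) (α β : ℝ) (t : Space d) (K : Finset (Fin d → ℤ))
    (c : (Fin d → ℤ) → ℂ) (j : Fin d → ℤ) :
    ‖∑ k ∈ K, conj (c k) * preGramian g α β t j k‖ₑ
      = ‖∑ k ∈ K, c k * g (t + latticePoint α j - latticePoint (1 / β) k)‖ₑ := by
  rw [← enorm_norm, ← RCLike.norm_conj, enorm_norm]
  simp only [preGramian, map_sum, map_mul, Complex.conj_conj]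

theorem tsum_enorm_sq_translates (g : L2 d) (α β : ℝ) (t : Space d) (K : Finset (Fin d → ℤ))
    (c : (Fin d → ℤ) → ℂ) :
    ∑' j : Fin d → ℤ, ‖∑ k ∈ K, c k * g (t - latticePoint α j - latticePoint (1 / β) k)‖ₑ ^ 2
      = colEnergy (preGramian g α β t) K fun k => conj (c k) := by
  rw [← (Equiv.neg (Fin d → ℤ)).tsum_eq, colEnergy]
  simp only [norm_sum_conj_mul_preGramian, Equiv.neg_apply, latticePoint_neg, sub_neg_eq_add]

/-- The norm of a finite linear combination of the Gabor system over the adjoint lattice. -/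
theorem enorm_sq_sum_system (g : L2 d) {α : ℝ} (hα : 0 < α) (β : ℝ) (K L : Finset (Fin d → ℤ))
    (c : (Fin d → ℤ) × (Fin d → ℤ) → ℂ) :
    ‖∑ p ∈ K ×ˢ L, c p • system g (1 / β) (1 / α) p‖ₑ ^ 2
      = ∫⁻ t in cube 0 α, colEnergy (preGramian g α β t) K fun k =>
          conj (∑ l ∈ L, c (k, l) * character (latticePoint (1 / α) l) t) := by
  have hab : α * (1 / α) = 1 := by field_simp
  set S : Space d → ℂ := fun t => ∑ k ∈ K, (∑ l ∈ L, c (k, l) *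
    character (latticePoint (1 / α) l) t) * g (t - latticePoint (1 / β) k) with hS
  have hSm : Measurable S := by
    refine Finset.measurable_fun_sum _ fun k _ => ?_
    exact (continuous_sum_character (1 / α) L fun l => c (k, l)).measurable.mul
      ((measurable_coe_L2 g).comp (by fun_prop))
  have hae : (∑ p ∈ K ×ˢ L, c p • system g (1 / β) (1 / α) p : L2 d) =ᵐ[volume] S := by
    have h1 : ∀ᵐ t, ∀ p : (Fin d → ℤ) × (Fin d → ℤ),
        (c p • system g (1 / β) (1 / α) p : L2 d) t = c p *
          (character (latticePoint (1 / α) p.2) t * g (t - latticePoint (1 / β) p.1)) := by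
      refine ae_all_iff.2 fun p => ?_
      filter_upwards [Lp.coeFn_smul (c p) (system g (1 / β) (1 / α) p),
        coeFn_system g (1 / β) (1 / α) p.1 p.2] with t h1 h2
      rw [h1, Pi.smul_apply, h2, smul_eq_mul]
    filter_upwards [Lp.coeFn_finsetSum (K ×ˢ L) fun p => c p • system g (1 / β) (1 / α) p, h1]
      with t h2 h1
    rw [h2, Finset.sum_apply, Finset.sum_product]
    simp only [h1, hS, Finset.sum_mul]
    exact Finset.sum_congr rfl fun k _ => Finset.sum_congr rfl fun l _ => by ring
  rw [L2.enorm_sq_eq_lintegral hae, lintegral_eq_lintegral_cube hα 0 (hSm.enorm.pow_const 2)]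
  refine lintegral_congr fun t => ?_
  rw [← tsum_enorm_sq_translates]
  have hper : ∀ j l : Fin d → ℤ, character (latticePoint (1 / α) l) (t - latticePoint α j)
      = character (latticePoint (1 / α) l) t := by
    intro j l
    rw [← character_add_latticePoint hab l j (t - latticePoint α j), sub_add_cancel]
  simp only [hS, hper]

/-- Bounds for almost all pre-Gramians give the Riesz property over the adjoint lattice. -/
theorem isRieszSequence_of_ae_finiteBounds {g : L2 d} {α β A B : ℝ} (hα : 0 < α) (hA : 0 < A)
    (hB : 0 < B) (h : ∀ᵐ x : Space d, FiniteBounds (preGramian g α β x) A B) :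
    IsRieszSequence (system g (1 / β) (1 / α)) := by
  classical
  have hab : α * (1 / α) = 1 := by field_simp
  have hb : 0 < 1 / α := by positivity
  have had : 0 < α ^ d := by positivity
  have hprod : ∀ (K L : Finset (Fin d → ℤ)) (c : (Fin d → ℤ) × (Fin d → ℤ) → ℂ),
      ENNReal.ofReal (A * α ^ d) * ∑ p ∈ K ×ˢ L, ‖c p‖ₑ ^ 2
        ≤ ‖∑ p ∈ K ×ˢ L, c p • system g (1 / β) (1 / α) p‖ₑ ^ 2 ∧
      ‖∑ p ∈ K ×ˢ L, c p • system g (1 / β) (1 / α) p‖ₑ ^ 2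
        ≤ ENNReal.ofReal (B * α ^ d) * ∑ p ∈ K ×ˢ L, ‖c p‖ₑ ^ 2 := by
    intro K L c
    have h1 : ∫⁻ t in cube (0 : Space d) α, ∑ k ∈ K,
        ‖conj (∑ l ∈ L, c (k, l) * character (latticePoint (1 / α) l) t)‖ₑ ^ 2
        = ENNReal.ofReal (α ^ d) * ∑ p ∈ K ×ˢ L, ‖c p‖ₑ ^ 2 := by
      rw [lintegral_finsetSum, Finset.sum_product, Finset.mul_sum]
      · refine Finset.sum_congr rfl fun k _ => ?_
        rw [← lintegral_enorm_sq_sum_character hb hab 0 L fun l => c (k, l)]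
        refine lintegral_congr fun t => ?_
        rw [← enorm_norm, RCLike.norm_conj, enorm_norm]
      · intro k _
        exact ((Complex.continuous_conj.comp
          (continuous_sum_character (1 / α) L fun l => c (k, l))).measurable.enorm.pow_const 2)
    have h' := ae_restrict_of_ae (s := cube 0 α) h
    rw [enorm_sq_sum_system g hα, ENNReal.ofReal_mul hA.le, ENNReal.ofReal_mul hB.le, mul_assoc,
      mul_assoc, ← h1]
    constructor
    · rw [← lintegral_const_mul' _ _ ENNReal.ofReal_ne_top]
      exact lintegral_mono_ae (h'.mono fun t ht => (ht K _).1)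
    · rw [← lintegral_const_mul' _ _ ENNReal.ofReal_ne_top]
      exact lintegral_mono_ae (h'.mono fun t ht => (ht K _).2)
  have hfin : ∀ (K : Finset ((Fin d → ℤ) × (Fin d → ℤ))) (c : (Fin d → ℤ) × (Fin d → ℤ) → ℂ),
      A * α ^ d * ∑ p ∈ K, ‖c p‖ ^ 2 ≤ ‖∑ p ∈ K, c p • system g (1 / β) (1 / α) p‖ ^ 2 ∧
      ‖∑ p ∈ K, c p • system g (1 / β) (1 / α) p‖ ^ 2 ≤ B * α ^ d * ∑ p ∈ K, ‖c p‖ ^ 2 := by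
    intro K c
    -- The norm formula needs a product index set; an arbitrary finite set is enlarged to one, with
    -- coefficients extended by zero.
    have hsub : K ⊆ K.image Prod.fst ×ˢ K.image Prod.snd := Finset.subset_product
    have h1 := hprod (K.image Prod.fst) (K.image Prod.snd) fun p => if p ∈ K then c p else 0
    have e1 : ∑ p ∈ K.image Prod.fst ×ˢ K.image Prod.snd,
        (if p ∈ K then c p else 0) • system g (1 / β) (1 / α) p
        = ∑ p ∈ K, c p • system g (1 / β) (1 / α) p := by
      rw [← Finset.sum_subset hsub fun p _ hp => by rw [if_neg hp, zero_smul]]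
      exact Finset.sum_congr rfl fun p hp => by rw [if_pos hp]
    have e2 : ∑ p ∈ K.image Prod.fst ×ˢ K.image Prod.snd, ‖if p ∈ K then c p else 0‖ₑ ^ 2
        = ∑ p ∈ K, ‖c p‖ₑ ^ 2 := by
      rw [← Finset.sum_subset hsub fun p _ hp => by simp [hp]]
      exact Finset.sum_congr rfl fun p hp => by rw [if_pos hp]
    rw [e1, e2, sum_enorm_sq, enorm_sq_eq_ofReal, ofReal_mul_ofReal_le_iff (by positivity)
      (sq_nonneg _), le_ofReal_mul_ofReal_iff (by positivity)
      (Finset.sum_nonneg fun _ _ => sq_nonneg _)] at h1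
    exact h1
  obtain ⟨T, hT⟩ := exists_isSynthesis (B := B * α ^ d) (by positivity) fun K c => (hfin K c).2
  refine ⟨A * α ^ d, B * α ^ d, by positivity, by positivity, fun c => ?_⟩
  rw [(hT.hasSum c).tsum_eq]
  exact ⟨(hT.hasSum c).summable, hT.le_norm_sq (fun K c => (hfin K c).1) c,
    hT.norm_sq_le (fun K c => (hfin K c).2) c⟩

theorem IsRieszSequence.exists_isSynthesis {I H : Type*} [DecidableEq I] [NormedAddCommGroup H]
    [InnerProductSpace ℂ H] [CompleteSpace H] {e : I → H} (he : IsRieszSequence e) :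
    ∃ (A B : ℝ) (T : SeqL2 I →L[ℂ] H), 0 < A ∧ 0 < B ∧ IsSynthesis T e ∧
      ∀ c, A * ‖c‖ ^ 2 ≤ ‖T c‖ ^ 2 ∧ ‖T c‖ ^ 2 ≤ B * ‖c‖ ^ 2 := by
  obtain ⟨A, B, hA, hB, h⟩ := he
  obtain ⟨T, hT⟩ := Gabor.exists_isSynthesis hB.le (e := e) fun K c => by
    have h1 := (h (∑ i ∈ K, lp.single 2 i (c i))).2.2
    simp only [SeqL2.sum_single_apply, SeqL2.norm_sq_sum_single] at h1
    rw [tsum_eq_sum (s := K) fun k hk => by rw [if_neg hk, zero_smul],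
      Finset.sum_congr rfl fun k hk => by rw [if_pos hk]] at h1
    exact h1
  refine ⟨A, B, T, hA, hB, hT, fun c => ?_⟩
  rw [← (hT.hasSum c).tsum_eq]
  exact (h c).2

end Riesz

/-! ### The Riesz property implies pointwise bounds, by localisation. -/

section Localization

variable {d : ℕ}

/-- The union of the translates of `E` along the lattice `aℤ^d`. -/
def periodization (E : Set (Space d)) (a : ℝ) : Set (Space d) :=
  ⋃ j : Fin d → ℤ, (fun t => t + latticePoint a j) ⁻¹' E

theorem measurableSet_periodization {E : Set (Space d)} (hE : MeasurableSet E) (a : ℝ) :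
    MeasurableSet (periodization E a) :=
  MeasurableSet.iUnion fun _ => hE.preimage (by fun_prop)

theorem sub_latticePoint_mem_periodization {a : ℝ} (ha : 0 < a) {v : Space d} {E : Set (Space d)}
    (hE : E ⊆ cube v a) {t : Space d} (ht : t ∈ cube v a) (j : Fin d → ℤ) :
    t - latticePoint a j ∈ periodization E a ↔ t ∈ E := by
  rw [periodization, Set.mem_iUnion]
  constructor
  · rintro ⟨i, hi⟩
    have h1 : t - latticePoint a j + latticePoint a i = t + latticePoint a (i - j) := by
      rw [sub_eq_add_neg i j, latticePoint_add, latticePoint_neg]; abel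
    rw [Set.mem_preimage, h1] at hi
    have h0 : i - j = 0 := eq_of_mem_cube ha (hE hi) (by simpa [latticePoint_zero] using ht)
    simpa [h0, latticePoint_zero] using hi
  · intro h
    exact ⟨j, by simpa using h⟩

/-- The function `∑_{k ∈ K} c_k g(t - s k)`, restricted to the periodization of `E`. -/
noncomputable def localizedSum (g : Space d → ℂ) (E : Set (Space d)) (a s : ℝ)
    (K : Finset (Fin d → ℤ)) (c : (Fin d → ℤ) → ℂ) : Space d → ℂ :=
  (periodization E a).indicator fun t => ∑ k ∈ K, c k * g (t - latticePoint s k)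

theorem memLp_localizedSum (g : L2 d) {E : Set (Space d)} (hE : MeasurableSet E) (a s : ℝ)
    (K : Finset (Fin d → ℤ)) (c : (Fin d → ℤ) → ℂ) :
    MemLp (localizedSum g E a s K c) 2 volume :=
  (memLp_finsetSum K fun k _ => (memLp_comp_sub g (latticePoint s k)).const_mul (c k)).indicator
    (measurableSet_periodization hE a)

theorem measurable_localizedSum {g : Space d → ℂ} (hg : Measurable g) {E : Set (Space d)}
    (hE : MeasurableSet E) (a s : ℝ) (K : Finset (Fin d → ℤ)) (c : (Fin d → ℤ) → ℂ) :
    Measurable (localizedSum g E a s K c) := by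
  refine Measurable.indicator ?_ (measurableSet_periodization hE a)
  exact Finset.measurable_fun_sum _ fun k _ => (hg.comp (by fun_prop)).const_mul (c k)

theorem localizedSum_sub (g : Space d → ℂ) {a : ℝ} (ha : 0 < a) {v : Space d} {E : Set (Space d)}
    (hE : E ⊆ cube v a) (s : ℝ) (K : Finset (Fin d → ℤ)) (c : (Fin d → ℤ) → ℂ) {t : Space d}
    (ht : t ∈ cube v a) (j : Fin d → ℤ) :
    localizedSum g E a s K c (t - latticePoint a j)
      = E.indicator (fun t => ∑ k ∈ K, c k * g (t - latticePoint a j - latticePoint s k)) t := by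
  classical
  simp only [localizedSum, Set.indicator_apply, sub_latticePoint_mem_periodization ha hE ht]

/-- The cut-off set is `α`-periodic, so on each fiber it acts as multiplication by the number
`1_E(t)`. -/
theorem enorm_sq_localizedSum (g : L2 d) {α : ℝ} (hα : 0 < α) (β : ℝ) {v : Space d}
    {E : Set (Space d)} (hE : E ⊆ cube v α) (hEm : MeasurableSet E) (K : Finset (Fin d → ℤ))
    (c : (Fin d → ℤ) → ℂ) {f : L2 d} (hf : f =ᵐ[volume] localizedSum g E α (1 / β) K c) :
    ‖f‖ₑ ^ 2 = ∫⁻ t in E, colEnergy (preGramian g α β t) K fun k => conj (c k) := by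
  rw [L2.enorm_sq_eq_lintegral hf, lintegral_eq_lintegral_cube hα v
    ((measurable_localizedSum (measurable_coe_L2 g) hEm α (1 / β) K c).enorm.pow_const 2),
    ← setLIntegral_indicator_of_subset hEm hE]
  refine setLIntegral_congr_fun (measurableSet_cube v α) fun t ht => ?_
  simp only [localizedSum_sub _ hα hE (1 / β) K c ht]
  by_cases h : t ∈ E
  · simp only [Set.indicator_of_mem h, tsum_enorm_sq_translates]
  · simp [Set.indicator_of_notMem h]

/-- The inner product with a localized sum, computed on the fibers. -/
theorem HasFiniteFibers.inner_localizedSum {F : Space d → ℂ} {v : Space d} {a : ℝ} (ha : 0 < a)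
    {L : Finset (Fin d → ℤ)} (hF : HasFiniteFibers F v a L) {f : L2 d} (hf : f =ᵐ[volume] F)
    (g : L2 d) {E : Set (Space d)} (hE : E ⊆ cube v a) (hEm : MeasurableSet E) (s : ℝ)
    (K : Finset (Fin d → ℤ)) (c : (Fin d → ℤ) → ℂ) {u : L2 d}
    (hu : u =ᵐ[volume] localizedSum g E a s K c) :
    inner ℂ f u = ∑ k ∈ K, c k * ∫ t in cube v a,
      conj (bracket g F s a L k t) * E.indicator 1 t := by
  set h : Space d → ℂ := fun t => conj (F t) * localizedSum g E a s K c t with hh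
  have hint : Integrable h := MemLp.integrable_mul (p := 2) (q := 2)
    ((Lp.memLp f).ae_eq hf).star (memLp_localizedSum g hEm a s K c)
  have h1 : inner ℂ f u = ∫ t, h t := by
    rw [L2.inner_def]
    refine integral_congr_ae ?_
    filter_upwards [hf, hu] with t h1 h2
    rw [RCLike.inner_apply, h1, h2, mul_comm]
  have hbr : ∀ k, Integrable (fun t => conj (bracket g F s a L k t) * E.indicator 1 t)
      (volume.restrict (cube v a)) := by
    intro k
    refine MemLp.integrable_mul (p := 2) (q := 2) (hF.memLp_bracket g s k).star ?_
    exact memLp_indicator_const 2 hEm (1 : ℂ) (.inr (measure_ne_top _ _))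
  rw [h1, ← (hasSum_integral_cube ha v hint).tsum_eq, tsum_eq_sum (s := L)]
  · simp only [← integral_const_mul]
    rw [← integral_finsetSum, ← integral_finsetSum]
    · refine setIntegral_congr_fun (measurableSet_cube v a) fun t ht => ?_
      simp only [hh, localizedSum_sub _ ha hE s K c ht, bracket, map_sum, map_mul, Complex.conj_conj]
      by_cases hmem : t ∈ E
      · simp only [Set.indicator_of_mem hmem, Pi.one_apply, mul_one, Finset.mul_sum]
        rw [Finset.sum_comm]
        exact Finset.sum_congr rfl fun k _ => Finset.sum_congr rfl fun l _ => by ring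
      · simp [Set.indicator_of_notMem hmem]
    · exact fun k _ => (hbr k).const_mul _
    · intro k _
      exact ((measurePreserving_sub_right volume (latticePoint a k)).integrable_comp_of_integrable
        hint).integrableOn
  · intro k hk
    refine (setIntegral_congr_fun (measurableSet_cube v a) fun t ht => ?_).trans (integral_zero _ ℂ)
    simp only [hh, hF.eq_zero t ht k hk, map_zero, zero_mul]

theorem tsum_enorm_sq_finset_mul {I J : Type*} [DecidableEq I] (K : Finset I) (c : I → ℂ)
    (w : J → ℂ) :
    ∑' p : I × J, ‖if p.1 ∈ K then c p.1 * w p.2 else 0‖ₑ ^ 2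
      = (∑ k ∈ K, ‖c k‖ₑ ^ 2) * ∑' l, ‖w l‖ₑ ^ 2 := by
  rw [ENNReal.tsum_prod (f := fun k l => ‖if k ∈ K then c k * w l else 0‖ₑ ^ 2),
    tsum_eq_sum (s := K) fun k hk => by simp [hk], Finset.sum_mul]
  refine Finset.sum_congr rfl fun k hk => ?_
  rw [← ENNReal.tsum_mul_left]
  exact tsum_congr fun l => by rw [if_pos hk, enorm_mul, mul_pow]

/-- The synthesis operator of the Gabor system over the adjoint lattice maps the tensor product of
a finite sequence and the Fourier coefficients of `1_E` to a localized sum. -/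
theorem IsSynthesis.apply_tensor {g : L2 d} {α β : ℝ} (hα : 0 < α)
    {T : SeqL2 ((Fin d → ℤ) × (Fin d → ℤ)) →L[ℂ] L2 d}
    (hT : IsSynthesis T (system g (1 / β) (1 / α))) {v : Space d} {E : Set (Space d)}
    (hE : E ⊆ cube v α) (hEm : MeasurableSet E) (K : Finset (Fin d → ℤ)) (c : (Fin d → ℤ) → ℂ)
    {w : SeqL2 ((Fin d → ℤ) × (Fin d → ℤ))}
    (hw : ∀ p, w p = if p.1 ∈ K then
      c p.1 * (((α : ℂ) ^ d)⁻¹ * cubeCoeff v α (1 / α) (E.indicator 1) p.2) else 0)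
    {u : L2 d} (hu : u =ᵐ[volume] localizedSum g E α (1 / β) K c) : T w = u := by
  have hab : α * (1 / α) = 1 := by field_simp
  have hb : 0 < 1 / α := by positivity
  have had : (α : ℂ) ^ d ≠ 0 := by
    have : (α : ℂ) ≠ 0 := by exact_mod_cast hα.ne'
    exact pow_ne_zero _ this
  -- Pairing with a dense set of `f` turns the claim into a double series; for each `k` the sum over
  -- `l` is Parseval for `1_E` and the bracket of `f` with `g`.
  refine (dense_hasFiniteFibers v hα).eq_of_inner_right (𝕜 := ℂ) fun f hf => ?_
  obtain ⟨F, L, hF, hf⟩ := hf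
  rw [hF.inner_localizedSum hα hf g hE hEm (1 / β) K c hu]
  have h1 : HasSum (fun p => w p * inner ℂ f (system g (1 / β) (1 / α) p)) (inner ℂ f (T w)) := by
    refine ((hT.hasSum w).mapL (innerSL ℂ f)).congr_fun fun p => ?_
    rw [innerSL_apply_apply, inner_smul_right]
  have h2 : ∀ k, HasSum (fun l => w (k, l) * inner ℂ f (system g (1 / β) (1 / α) (k, l)))
      (if k ∈ K then c k * ∫ t in cube v α,
        conj (bracket g F (1 / β) α L k t) * E.indicator 1 t else 0) := by
    intro k
    by_cases hk : k ∈ K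
    · have h3 := (hasSum_cubeCoeff (v := v) hb hab (measurable_one.indicator hEm)
        (measurable_bracket (measurable_coe_L2 g) hF.measurable (1 / β) α L k)
        (memLp_indicator_const 2 hEm (1 : ℂ) (.inr (measure_ne_top _ _)))
        (hF.memLp_bracket g (1 / β) k)).mul_left (c k * ((α : ℂ) ^ d)⁻¹)
      have hval : ∀ z : ℂ, c k * z = c k * ((α : ℂ) ^ d)⁻¹ * ((α : ℂ) ^ d * z) := by
        intro z
        field_simp
      rw [if_pos hk, hval]
      refine h3.congr_fun fun l => ?_
      rw [hw, if_pos hk, ← inner_conj_symm, hF.inner_system hb hab hf]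
      ring
    · simp only [hw, if_neg hk, zero_mul]
      exact hasSum_zero
  have h3 := h1.prod_fiberwise h2
  rw [← h3.tsum_eq, tsum_eq_sum (s := K) fun k hk => if_neg hk]
  exact Finset.sum_congr rfl fun k hk => if_pos hk

theorem IsRieszSequence.ae_twoSidedBounds {g : L2 d} {α β : ℝ} (hα : 0 < α)
    (h : IsRieszSequence (system g (1 / β) (1 / α))) :
    ∃ A B : ℝ, 0 < A ∧ 0 < B ∧ ∀ᵐ x : Space d, TwoSidedBounds (preGramian g α β x) A B := by
  classical
  obtain ⟨A, B, T, hA, hB, hT, hb⟩ := h.exists_isSynthesis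
  have hα1 : 0 < 1 / α := by positivity
  have hab : α * (1 / α) = 1 := by field_simp
  have had : 0 < α ^ d := pow_pos hα d
  refine ⟨A * (α ^ d)⁻¹, B * (α ^ d)⁻¹, by positivity, by positivity, ?_⟩
  refine Filter.Eventually.mono (ae_of_forall_cube hα fun v =>
    ae_finiteBounds (measurable_preGramian g α β) (A := A * (α ^ d)⁻¹) (B := B * (α ^ d)⁻¹) ?_)
    fun x hx => hx.twoSidedBounds (by positivity) (by positivity)
  intro K c E hE
  rw [Measure.restrict_restrict hE, Measure.restrict_apply hE]
  have hEm := hE.inter (measurableSet_cube v α)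
  have hsub : E ∩ cube v α ⊆ cube v α := Set.inter_subset_right
  set E' := E ∩ cube v α
  have hfin : volume E' ≠ ∞ := ((measure_mono hsub).trans_lt (volume_cube_lt_top v _)).ne
  -- These are the normalised Fourier coefficients of `1_{E'}`, so `‖a‖² = α^{-d} |E'|`; this is the
  -- source of the factor `α^{-d}` in the bounds.
  set a : (Fin d → ℤ) → ℂ := fun l =>
    ((α : ℂ) ^ d)⁻¹ * cubeCoeff v α (1 / α) (E'.indicator 1) l with ha
  have hae : ∑' l, ‖a l‖ₑ ^ 2 = ENNReal.ofReal (α ^ d)⁻¹ * volume E' := by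
    have h1 := tsum_enorm_sq_cubeCoeff (v := v) hα1 hab (measurable_one.indicator hEm)
      (memLp_indicator_const 2 hEm (1 : ℂ) (.inr (measure_ne_top _ _)))
    have h2 : ∫⁻ t in cube v α, ‖E'.indicator (1 : Space d → ℂ) t‖ₑ ^ 2 = volume E' := by
      rw [← setLIntegral_one, ← setLIntegral_indicator_of_subset hEm hsub]
      refine lintegral_congr fun t => ?_
      by_cases h : t ∈ E' <;> simp [h]
    have hn : ‖((α : ℂ) ^ d)⁻¹‖ₑ = ENNReal.ofReal (α ^ d)⁻¹ := by
      rw [← ofReal_norm, norm_inv, norm_pow, Complex.norm_real, Real.norm_of_nonneg hα.le]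
    have h3 : ENNReal.ofReal (α ^ d)⁻¹ * ENNReal.ofReal (α ^ d) = 1 := by
      rw [← ENNReal.ofReal_mul (by positivity), inv_mul_cancel₀ had.ne', ENNReal.ofReal_one]
    simp only [ha, enorm_mul, mul_pow, hn]
    rw [ENNReal.tsum_mul_left, h1, h2, sq, ← mul_assoc, mul_assoc (ENNReal.ofReal (α ^ d)⁻¹), h3, mul_one]
  have hwe := tsum_enorm_sq_finset_mul K (fun k => conj (c k)) a
  have hws := summable_norm_sq (u := fun p : (Fin d → ℤ) × (Fin d → ℤ) =>
    if p.1 ∈ K then conj (c p.1) * a p.2 else 0) (by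
      rw [hwe, hae]
      exact ENNReal.mul_ne_top (by simp) (ENNReal.mul_ne_top ENNReal.ofReal_ne_top hfin))
  set w : SeqL2 ((Fin d → ℤ) × (Fin d → ℤ)) := ⟨_, memℓp_two_of_summable hws⟩ with hw
  -- The pre-Gramian has conjugated entries; conjugating the coefficients here makes the energy come
  -- out at `c` itself.
  have hL := memLp_localizedSum g hEm α (1 / β) K fun k => conj (c k)
  have hTw : T w = hL.toLp _ := hT.apply_tensor hα hsub hEm K _ (fun _ => rfl) hL.coeFn_toLp
  have hcc : ∀ z : ℂ, ‖conj z‖ₑ = ‖z‖ₑ := fun z => by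
    rw [← enorm_norm, RCLike.norm_conj, enorm_norm]
  have hnT := enorm_sq_localizedSum g hα β hsub hEm K _ hL.coeFn_toLp
  rw [← hTw] at hnT
  simp only [Complex.conj_conj] at hnT
  have hnw : ‖w‖ₑ ^ 2 = (∑ k ∈ K, ‖c k‖ₑ ^ 2) * (ENNReal.ofReal (α ^ d)⁻¹ * volume E') := by
    rw [← SeqL2.tsum_enorm_sq, ← hae]
    refine hwe.trans ?_
    simp only [hcc]
  have key := hb w
  rw [← ofReal_mul_ofReal_le_iff hA.le (sq_nonneg _), ← le_ofReal_mul_ofReal_iff hB.le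
    (sq_nonneg _), ← enorm_sq_eq_ofReal, ← enorm_sq_eq_ofReal, hnT, hnw] at key
  rw [ENNReal.ofReal_mul hA.le, ENNReal.ofReal_mul hB.le]
  constructor
  · calc _ = ENNReal.ofReal A * ((∑ k ∈ K, ‖c k‖ₑ ^ 2) * (ENNReal.ofReal (α ^ d)⁻¹ * volume E')) := by
          ring
      _ ≤ _ := key.1
  · calc _ ≤ ENNReal.ofReal B * ((∑ k ∈ K, ‖c k‖ₑ ^ 2) * (ENNReal.ofReal (α ^ d)⁻¹ * volume E')) :=
          key.2
      _ = _ := by ring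

end Localization

/-! ### Commutation with time-frequency shifts and the canonical dual window. -/

section Shifts

variable {d : ℕ}

theorem coeFn_tfShift (x ξ : Space d) (f : L2 d) :
    tfShift x ξ f =ᵐ[volume] fun t => character ξ t * f (t - x) :=
  (memLp_tfShiftFun x ξ f).coeFn_toLp

theorem ae_comp_sub {p : Space d → Prop} (h : ∀ᵐ t, p t) (x : Space d) : ∀ᵐ t, p (t - x) :=
  (measurePreserving_sub_right volume x).quasiMeasurePreserving.ae h

theorem inner_tfShift (x ξ : Space d) (f h : L2 d) :
    inner ℂ (tfShift x ξ f) (tfShift x ξ h) = inner ℂ f h := by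
  rw [L2.inner_def, L2.inner_def, ← integral_sub_right_eq_self (fun t => inner ℂ (f t) (h t)) x]
  refine integral_congr_ae ?_
  filter_upwards [coeFn_tfShift x ξ f, coeFn_tfShift x ξ h] with t h1 h2
  rw [h1, h2, RCLike.inner_apply, RCLike.inner_apply, map_mul]
  linear_combination (h (t - x) * conj (f (t - x))) * conj_character_mul_self ξ t

/-- The time-frequency shift as a linear isometry. -/
noncomputable def tfShiftLI (x ξ : Space d) : L2 d →ₗᵢ[ℂ] L2 d :=
  LinearMap.isometryOfInner
    { toFun := tfShift x ξ
      map_add' := fun f h => by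
        refine Lp.ext ?_
        filter_upwards [coeFn_tfShift x ξ (f + h), coeFn_tfShift x ξ f, coeFn_tfShift x ξ h,
          Lp.coeFn_add (tfShift x ξ f) (tfShift x ξ h), ae_comp_sub (Lp.coeFn_add f h) x]
          with t h1 h2 h3 h4 h5
        rw [h1, h4, Pi.add_apply, h2, h3, h5, Pi.add_apply, mul_add]
      map_smul' := fun z f => by
        refine Lp.ext ?_
        filter_upwards [coeFn_tfShift x ξ (z • f), coeFn_tfShift x ξ f,
          Lp.coeFn_smul z (tfShift x ξ f), ae_comp_sub (Lp.coeFn_smul z f) x]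
          with t h1 h2 h3 h4
        rw [h1, RingHom.id_apply, h3, Pi.smul_apply, h2, h4, Pi.smul_apply, smul_eq_mul,
          smul_eq_mul, mul_left_comm] }
    (inner_tfShift x ξ)

theorem tfShiftLI_apply (x ξ : Space d) (f : L2 d) : tfShiftLI x ξ f = tfShift x ξ f := rfl

theorem tfShift_tfShift (x ξ y η : Space d) (f : L2 d) :
    tfShift x ξ (tfShift y η f) = character η (-x) • tfShift (x + y) (ξ + η) f := by
  refine Lp.ext ?_
  filter_upwards [coeFn_tfShift x ξ (tfShift y η f), ae_comp_sub (coeFn_tfShift y η f) x,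
    coeFn_tfShift (x + y) (ξ + η) f, Lp.coeFn_smul (character η (-x)) (tfShift (x + y) (ξ + η) f)]
    with t h1 h2 h3 h4
  rw [h1, h2, h4, Pi.smul_apply, h3, smul_eq_mul, character_add_left, sub_eq_add_neg t x,
    character_add_right, ← sub_eq_add_neg, sub_sub]
  ring

theorem tfShiftLI_system (g : L2 d) (a b : ℝ) (p q : (Fin d → ℤ) × (Fin d → ℤ)) :
    tfShiftLI (latticePoint a p.1) (latticePoint b p.2) (system g a b q)
      = character (latticePoint b q.2) (-latticePoint a p.1) • system g a b (p + q) := by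
  rw [tfShiftLI_apply, system, tfShift_tfShift, system, Prod.fst_add, Prod.snd_add,
    latticePoint_add, latticePoint_add]

/-- The frame operator of a Gabor system commutes with the time-frequency shifts of its lattice. -/
theorem IsSynthesis.frameOperator_tfShiftLI {g : L2 d} {a b : ℝ}
    {T : SeqL2 ((Fin d → ℤ) × (Fin d → ℤ)) →L[ℂ] L2 d} (hT : IsSynthesis T (system g a b))
    (p : (Fin d → ℤ) × (Fin d → ℤ)) (f : L2 d) :
    T (ContinuousLinearMap.adjoint T (tfShiftLI (latticePoint a p.1) (latticePoint b p.2) f))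
      = tfShiftLI (latticePoint a p.1) (latticePoint b p.2)
        (T (ContinuousLinearMap.adjoint T f)) := by
  set W := tfShiftLI (latticePoint a p.1) (latticePoint b p.2) with hW
  have h1 := (hT.hasSum (ContinuousLinearMap.adjoint T f)).mapL W.toContinuousLinearMap
  -- A shift permutes the system by `q ↦ p + q` up to a unimodular phase `z`. The phase occurs once
  -- in the coefficient and once, conjugated, in the vector, and cancels.
  have h2 := (Equiv.addLeft p).hasSum_iff.2 (hT.hasSum (ContinuousLinearMap.adjoint T (W f)))
  refine h2.unique (h1.congr_fun fun q => ?_)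
  simp only [Function.comp_apply, Equiv.coe_addLeft, hT.adjoint_apply,
    LinearIsometry.coe_toContinuousLinearMap, map_smul]
  set z := character (latticePoint b q.2) (-latticePoint a p.1) with hz
  have hzz : conj z * z = 1 := conj_character_mul_self _ _
  have h3 : W (system g a b q) = z • system g a b (p + q) := tfShiftLI_system g a b p q
  have h4 : system g a b (p + q) = conj z • W (system g a b q) := by
    rw [h3, smul_smul, hzz, one_smul]
  rw [h4, inner_smul_left, Complex.conj_conj, LinearIsometry.inner_map_map, smul_smul]
  congr 1
  linear_combination (inner ℂ (system g a b q) f) * hzz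

/-- The canonical dual window of a Gabor frame. -/
theorem IsFrame.exists_isDualWindow {g : L2 d} {a b : ℝ} (h : IsFrame (system g a b)) :
    ∃ γ : L2 d, IsDualWindow g γ a b := by
  classical
  obtain ⟨T, hT⟩ := h.isBessel.exists_isSynthesis
  obtain ⟨A, B, hA, -, hb⟩ := h
  set S := T ∘L ContinuousLinearMap.adjoint T with hS
  have hSs : IsSelfAdjoint S := (ContinuousLinearMap.isPositive_self_comp_adjoint T).isSelfAdjoint
  have hu : IsUnit S := by
    -- The lower frame bound makes `S` coercive: `⟨S f, f⟩ = ‖T* f‖² ≥ A ‖f‖²`.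
    refine ContinuousLinearMap.isUnit_of_forall_le_norm_inner_map _ (c := ⟨A, hA.le⟩) hA fun f => ?_
    have h1 : (inner ℂ (S f) f).re = ‖ContinuousLinearMap.adjoint T f‖ ^ 2 := by
      rw [hS, ContinuousLinearMap.comp_apply, ← ContinuousLinearMap.adjoint_inner_right,
        inner_self_eq_norm_sq_to_K]
      norm_cast
    calc ‖f‖ ^ 2 * A ≤ ‖ContinuousLinearMap.adjoint T f‖ ^ 2 := by
          rw [mul_comm, ← (hT.hasSum_norm_sq_inner f).tsum_eq]
          exact (hb f).2.1
      _ = _ := h1.symm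
      _ ≤ _ := Complex.re_le_norm _
  obtain ⟨u, hu⟩ := hu
  set V : L2 d →L[ℂ] L2 d := ↑u⁻¹ with hV
  have hVS : V ∘L S = ContinuousLinearMap.id ℂ _ := by rw [hV, ← hu]; exact u.inv_mul
  have hSV : S ∘L V = ContinuousLinearMap.id ℂ _ := by rw [hV, ← hu]; exact u.mul_inv
  have hVS' : ∀ f, V (S f) = f := fun f => congrArg (fun R : L2 d →L[ℂ] L2 d => R f) hVS
  have hSV' : ∀ f, S (V f) = f := fun f => congrArg (fun R : L2 d →L[ℂ] L2 d => R f) hSV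
  -- The inverse of `S` also commutes with the shifts, so the dual system is again a Gabor system.
  have hsys : ∀ p, system (V g) a b p = V (system g a b p) := by
    intro p
    have h1 := hT.frameOperator_tfShiftLI p (V g)
    change S _ = tfShiftLI _ _ (S (V g)) at h1
    rw [hSV'] at h1
    rw [← hVS' (system (V g) a b p)]
    exact congrArg V h1
  have hVT : IsSynthesis (V ∘L T) (system (V g) a b) := fun p => by
    rw [ContinuousLinearMap.comp_apply, hT p, hsys]
  refine ⟨V g, hVT.isBessel, fun f => ⟨?_, ?_⟩⟩
  · have h1 := hVT.hasSum (ContinuousLinearMap.adjoint T f)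
    simp only [hT.adjoint_apply] at h1
    convert h1 using 1
    exact (hVS' f).symm
  · have h1 := hT.hasSum (ContinuousLinearMap.adjoint (V ∘L T) f)
    simp only [hVT.adjoint_apply] at h1
    convert h1 using 1
    rw [ContinuousLinearMap.adjoint_comp]
    -- The second expansion is `T (V T)* = S V*`, the adjoint of `V S = I`.
    have h2 : S ∘L ContinuousLinearMap.adjoint V = ContinuousLinearMap.id ℂ _ := by
      have h3 := congrArg ContinuousLinearMap.adjoint hVS
      rwa [ContinuousLinearMap.adjoint_comp, hSs.adjoint_eq, ContinuousLinearMap.adjoint_id] at h3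
    exact (congrArg (fun R : L2 d →L[ℂ] L2 d => R f) h2).symm

end Shifts

/-! ### Janssen's relation and left inverses of the pre-Gramians. -/

section Janssen

variable {d : ℕ}

theorem TwoSidedBounds.tsum_enorm_sq_column_le {I : Type*} [DecidableEq I] {M : I → I → ℂ}
    {B : ℝ} (hB : 0 ≤ B) (h : TwoSidedBounds M 0 B) (k : I) :
    ∑' j, ‖M j k‖ₑ ^ 2 ≤ ENNReal.ofReal B := by
  simpa [colEnergy] using (h.finiteBounds le_rfl hB {k} 1).2

theorem tsum_enorm_mul_le {I : Type*} (u w : I → ℂ) :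
    ∑' j, ‖u j * w j‖ₑ ≤ ∑' j, ‖u j‖ₑ ^ 2 + ∑' j, ‖w j‖ₑ ^ 2 := by
  rw [← ENNReal.tsum_add]
  refine ENNReal.tsum_le_tsum fun j => ?_
  rw [enorm_mul, sq, sq]
  rcases le_total ‖u j‖ₑ ‖w j‖ₑ with h | h
  · exact (mul_le_mul' h le_rfl).trans le_add_self
  · exact (mul_le_mul' le_rfl h).trans le_self_add

theorem inner_stepFun_zero {a : ℝ} (ha : 0 < a) {v : Space d} {E : Set (Space d)}
    (hE : E ⊆ cube v a) (hEm : MeasurableSet E) (k : Fin d → ℤ) {f₁ f₂ : L2 d}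
    (hf₁ : f₁ =ᵐ[volume] stepFun E a {k} 1) (hf₂ : f₂ =ᵐ[volume] stepFun E a {0} 1) :
    inner ℂ f₂ f₁ = if k = 0 then ((volume.real E : ℝ) : ℂ) else 0 := by
  have h1 : inner ℂ f₂ f₁ = ∫ t, if k = 0 then E.indicator (1 : Space d → ℂ) t else 0 := by
    rw [L2.inner_def]
    refine integral_congr_ae ?_
    filter_upwards [hf₁, hf₂] with t h1 h2
    rw [RCLike.inner_apply, h1, h2]
    simp only [stepFun, Finset.sum_singleton, Pi.one_apply, one_mul, latticePoint_zero, add_zero]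
    by_cases h : t ∈ E
    · simp only [Set.indicator_of_mem h, Pi.one_apply, map_one, mul_one]
      by_cases h' : t + latticePoint a k ∈ E
      · have hk : k = 0 := eq_of_mem_cube ha (hE h') (by simpa [latticePoint_zero] using hE h)
        rw [Set.indicator_of_mem h', if_pos hk, Pi.one_apply]
      · rw [Set.indicator_of_notMem h', if_neg]
        rintro rfl
        exact h' (by simpa [latticePoint_zero] using h)
    · simp [Set.indicator_of_notMem h]
  rw [h1]
  split_ifs
  · rw [integral_indicator hEm]
    simp [measureReal_def]
  · simp

/-- Reconstruction by a dual window implies Janssen's relation. -/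
theorem IsDualWindow.janssenRelation {g γ : L2 d} {α β : ℝ} (hβ : 0 < β)
    (hg : IsBessel (system g α β)) (h : IsDualWindow g γ α β) : JanssenRelation g γ α β := by
  intro k
  have ha : 0 < 1 / β := by positivity
  have hab : 1 / β * β = 1 := by field_simp
  obtain ⟨B₁, hB₁, hg'⟩ := hg.ae_twoSidedBounds hβ
  obtain ⟨B₂, hB₂, hγ'⟩ := h.1.ae_twoSidedBounds hβ
  set φ : (Fin d → ℤ) → Space d → ℂ := fun j x => γ (x + latticePoint α j) *
    conj (g (x + latticePoint α j - latticePoint (1 / β) k)) with hφ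
  have hφ' : ∀ j x, φ j x = conj (preGramian γ α β x j 0) * preGramian g α β x j k := by
    intro j x
    simp only [hφ, preGramian, latticePoint_zero, sub_zero, Complex.conj_conj]
  have hφm : ∀ j, Measurable (φ j) := fun j =>
    ((measurable_coe_L2 γ).comp (by fun_prop)).mul
      (Complex.continuous_conj.measurable.comp ((measurable_coe_L2 g).comp (by fun_prop)))
  -- Both factors are columns of pre-Gramians of Bessel systems, hence uniformly square-summable.
  -- This bound justifies exchanging sum and integral below.
  have hφb : ∀ᵐ x, ∑' j, ‖φ j x‖ₑ ≤ ENNReal.ofReal B₂ + ENNReal.ofReal B₁ := by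
    filter_upwards [hg', hγ'] with x h1 h2
    simp only [hφ']
    refine (tsum_enorm_mul_le _ _).trans (add_le_add ?_ (h1.tsum_enorm_sq_column_le hB₁.le k))
    refine le_of_eq_of_le (tsum_congr fun j => ?_) (h2.tsum_enorm_sq_column_le hB₂.le 0)
    rw [← enorm_norm, RCLike.norm_conj, enorm_norm]
  have hsum : ∀ᵐ x, Summable fun j => φ j x := by
    filter_upwards [hφb] with x hx
    refine Summable.of_norm ?_
    have := ENNReal.summable_toReal (ne_top_of_le_ne_top (by simp) hx)
    simpa using this
  refine ae_of_forall_cube ha fun v => ?_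
  set μ := volume.restrict (cube v (1 / β)) with hμ
  have hfin : ∀ E : Set (Space d), ∑' j, ∫⁻ x in E, ‖φ j x‖ₑ ∂μ ≠ ∞ := by
    intro E
    rw [← lintegral_tsum fun j => (hφm j).enorm.aemeasurable]
    refine ne_top_of_le_ne_top ?_ (lintegral_mono_ae
      (ae_restrict_of_ae (ae_restrict_of_ae hφb)))
    rw [lintegral_const]
    exact ENNReal.mul_ne_top (by simp) (measure_ne_top _ _)
  have hψi : Integrable (fun x => ∑' j, φ j x) μ := by
    refine ⟨(Measurable.tsum hφm).aestronglyMeasurable, ?_⟩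
    refine (lintegral_mono_ae ?_).trans_lt (lt_top_iff_ne_top.2 (?_ :
      ∫⁻ _, (ENNReal.ofReal B₂ + ENNReal.ofReal B₁) ∂μ ≠ ∞))
    · filter_upwards [ae_restrict_of_ae hφb] with x hx
      exact (enorm_tsum_le_tsum_enorm).trans hx
    · rw [lintegral_const]
      exact ENNReal.mul_ne_top (by simp) (measure_ne_top _ _)
  have key : (fun x => ∑' j, φ j x) =ᵐ[μ] fun _ => if k = 0 then (β : ℂ) ^ d else 0 := by
    refine hψi.ae_eq_of_forall_setIntegral_eq _ _ (integrable_const _) fun E hE _ => ?_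
    rw [integral_tsum (fun j => (hφm j).aestronglyMeasurable) (hfin E), setIntegral_const]
    have hEm := hE.inter (measurableSet_cube v (1 / β))
    have hsub : E ∩ cube v (1 / β) ⊆ cube v (1 / β) := Set.inter_subset_right
    have hEfin : volume (E ∩ cube v (1 / β)) ≠ ∞ :=
      ((measure_mono hsub).trans_lt (volume_cube_lt_top v _)).ne
    rw [hμ, Measure.restrict_restrict hE, measureReal_restrict_apply hE]
    set E' := E ∩ cube v (1 / β)
    -- The indicators of `E' - k/β` and of `E'`: pairing the expansion of the first with the second
    -- isolates `∑_j ∫_{E'} φ_j`, while their inner product is `|E'| δ_{k,0}`.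
    have hL₁ := memLp_stepFun hEm hEfin (1 / β) {k} 1
    have hL₂ := memLp_stepFun hEm hEfin (1 / β) {0} 1
    have h1 := (h.2 (hL₁.toLp _)).1.mapL (innerSL ℂ (hL₂.toLp _))
    simp only [innerSL_apply_apply, inner_smul_right] at h1
    rw [inner_stepFun_zero ha hsub hEm k hL₁.coeFn_toLp hL₂.coeFn_toLp] at h1
    have h2 := h1.prod_fiberwise fun j => (hasSum_inner_system hβ hab
      (hasFiniteFibers_stepFun ha hsub hEm {k} 1) (hasFiniteFibers_stepFun ha hsub hEm {0} 1)
      hL₁.coeFn_toLp hL₂.coeFn_toLp g γ α j).congr_fun fun l => by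
        rw [inner_conj_symm]; ring
    have h3 : ∀ j : Fin d → ℤ, ∫ t in cube v (1 / β),
        conj (bracket γ (stepFun E' (1 / β) {0} 1) α (1 / β) {0} (-j) t) *
          bracket g (stepFun E' (1 / β) {k} 1) α (1 / β) {k} (-j) t = ∫ t in E', φ j t := by
      intro j
      have : ∫ t in E', φ j t = ∫ t in cube v (1 / β), E'.indicator (φ j) t := by
        rw [setIntegral_indicator hEm, Set.inter_eq_self_of_subset_right hsub]
      rw [this]
      refine setIntegral_congr_fun (measurableSet_cube v _) fun t ht => ?_
      simp only [bracket_neg, Finset.sum_singleton, stepFun_sub ha hsub _ _ ht,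
        Finset.mem_singleton, if_true, Pi.one_apply, one_mul]
      by_cases hmem : t ∈ E'
      · simp only [Set.indicator_of_mem hmem, Pi.one_apply, one_mul, hφ']
      · simp [Set.indicator_of_notMem hmem]
    rw [← (Equiv.neg (Fin d → ℤ)).hasSum_iff] at h2
    have h4 := h2.tsum_eq
    simp only [Function.comp_def, Equiv.neg_apply, h3] at h4
    rw [tsum_mul_left] at h4
    have hβ' : (β : ℂ) ≠ 0 := by exact_mod_cast hβ.ne'
    have h5 : (β : ℂ) ^ d * ((1 / β : ℝ) : ℂ) ^ d = 1 := by
      rw [← mul_pow]; push_cast; rw [mul_one_div_cancel hβ', one_pow]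
    rw [← one_mul (∑' j, _), ← h5, mul_assoc, h4]
    split_ifs
    · rw [Complex.real_smul, mul_comm]
    · simp
  filter_upwards [key, ae_restrict_of_ae hsum] with x h1 h2
  rw [← h1]
  exact h2.hasSum

/-- A Bessel window satisfying Janssen's relation gives bounded left inverses of the
pre-Gramians. -/
theorem JanssenRelation.ae_exists_leftInverse {g γ : L2 d} {α β : ℝ} (hβ : 0 < β)
    (hg : IsBessel (system g α β)) (hγ : IsBessel (system γ α β))
    (h : JanssenRelation g γ α β) :
    ∃ C D : ℝ, ∀ᵐ x : Space d, ∃ P G : SeqL2 (Fin d → ℤ) →L[ℂ] SeqL2 (Fin d → ℤ),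
      ActsAs P (preGramian g α β x) ∧ ‖P‖ ≤ D ∧ G ∘L P = ContinuousLinearMap.id ℂ _ ∧ ‖G‖ ≤ C := by
  have hβd : (0 : ℝ) < β ^ d := pow_pos hβ d
  have hβ' : ((β : ℂ) ^ d) ≠ 0 := by exact_mod_cast hβd.ne'
  obtain ⟨B₁, hB₁, hg'⟩ := hg.ae_twoSidedBounds hβ
  obtain ⟨B₂, hB₂, hγ'⟩ := hγ.ae_twoSidedBounds hβ
  have hop : ∀ {B : ℝ} {M : (Fin d → ℤ) → (Fin d → ℤ) → ℂ}, 0 < B → TwoSidedBounds M 0 B →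
      ∃ P : SeqL2 (Fin d → ℤ) →L[ℂ] SeqL2 (Fin d → ℤ), ActsAs P M ∧ ‖P‖ ≤ Real.sqrt B := by
    intro B M hB hM
    obtain ⟨P, hP, hb⟩ := (hM.finiteBounds le_rfl hB.le).exists_actsAs le_rfl hB.le
    refine ⟨P, hP, ContinuousLinearMap.opNorm_le_bound _ (Real.sqrt_nonneg _) fun c => ?_⟩
    refine le_of_sq_le_sq ?_ (by positivity)
    rw [mul_pow, Real.sq_sqrt hB.le]
    exact (hb c).2
  have hJ : ∀ᵐ x : Space d, ∀ l k : Fin d → ℤ,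
      HasSum (fun j => conj (preGramian γ α β x j l) * preGramian g α β x j k)
        (if k = l then (β : ℂ) ^ d else 0) := by
    refine ae_all_iff.2 fun l => ae_all_iff.2 fun k => ?_
    -- The relation for `k - l` at the point `x - l/β` is the `(l, k)` entry of `P_γ(x)* P_g(x)`.
    filter_upwards [ae_comp_sub (h (k - l)) (latticePoint (1 / β) l)] with x hx
    simp only [sub_eq_zero] at hx
    refine hx.congr_fun fun j => ?_
    have e1 : x - latticePoint (1 / β) l + latticePoint α j
        = x + latticePoint α j - latticePoint (1 / β) l := by abel
    have e2 : x + latticePoint α j - latticePoint (1 / β) l - latticePoint (1 / β) (k - l)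
        = x + latticePoint α j - latticePoint (1 / β) k := by
      rw [sub_eq_add_neg k l, latticePoint_add, latticePoint_neg]; abel
    rw [e1, e2]
    simp only [preGramian, Complex.conj_conj]
  refine ⟨‖((β : ℂ) ^ d)⁻¹‖ * Real.sqrt B₂, Real.sqrt B₁, ?_⟩
  filter_upwards [hg', hγ', hJ] with x h1 h2 h3
  obtain ⟨P, hP, hPn⟩ := hop hB₁ h1
  obtain ⟨R, hR, hRn⟩ := hop hB₂ h2
  refine ⟨P, ((β : ℂ) ^ d)⁻¹ • ContinuousLinearMap.adjoint R, hP, hPn, ?_, ?_⟩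
  · refine lp.ext_continuousLinearMap (by simp) fun k => ?_
    ext l
    have h4 : inner ℂ (column hR.summable_column l) (column hP.summable_column k)
        = if k = l then (β : ℂ) ^ d else 0 := by
      rw [lp.inner_eq_tsum, ← (h3 l k).tsum_eq]
      refine tsum_congr fun j => ?_
      rw [RCLike.inner_apply, mul_comm]
      rfl
    simp only [ContinuousLinearMap.comp_apply, lp.singleContinuousLinearMap_apply,
      ContinuousLinearMap.id_apply]
    rw [hP.isSynthesis k, smul_apply, lp.coeFn_smul, Pi.smul_apply,
      hR.isSynthesis.adjoint_apply, h4]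
    by_cases hkl : k = l
    · subst hkl
      simp [hβ']
    · simp [hkl, Ne.symm hkl]
  · rw [norm_smul, LinearIsometryEquiv.norm_map]
    exact mul_le_mul_of_nonneg_left hRn (norm_nonneg _)

/-- Unfolding `∫ |g|² < ∞` over a cube of side `α`. The spectral condition cannot supply this,
because a divergent `tsum` in `ronShen` would silently be `0`. -/
theorem ae_summable_preGramian (g : L2 d) {α : ℝ} (hα : 0 < α) (β : ℝ) :
    ∀ᵐ x : Space d, ∀ k, Summable fun j => ‖preGramian g α β x j k‖ ^ 2 := by
  refine ae_all_iff.2 fun k => ae_of_forall_cube hα fun v => ?_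
  have hm : Measurable fun t => ‖g (t - latticePoint (1 / β) k)‖ₑ ^ 2 :=
    (((measurable_coe_L2 g).comp (by fun_prop)).enorm).pow_const 2
  have h1 := lintegral_eq_lintegral_cube hα v hm
  have hL := memLp_comp_sub g (latticePoint (1 / β) k)
  have h2 : ∫⁻ t, ‖g (t - latticePoint (1 / β) k)‖ₑ ^ 2 ≠ ∞ := by
    rw [← L2.enorm_sq_eq_lintegral hL.coeFn_toLp]
    exact ENNReal.pow_ne_top enorm_ne_top
  rw [h1] at h2
  have h3 := ae_lt_top (Measurable.tsum fun j => hm.comp (by fun_prop)) h2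
  filter_upwards [h3] with x hx
  refine summable_norm_sq ?_
  rw [← (Equiv.neg (Fin d → ℤ)).tsum_eq]
  refine ne_top_of_le_ne_top hx.ne (le_of_eq (tsum_congr fun j => ?_))
  simp only [preGramian, Equiv.neg_apply, latticePoint_neg, ← sub_eq_add_neg]
  rw [← enorm_norm, RCLike.norm_conj, enorm_norm]
  rfl

end Janssen

end Gabor

theorem mainTheorem9 (d : ℕ) (α β : ℝ) (hα : 0 < α) (hβ : 0 < β) (g : Gabor.L2 d) :
    List.TFAE [
      -- the Gabor system is a frame
      Gabor.IsFrame (Gabor.system g α β),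
      -- Bessel, with a Bessel dual window satisfying Janssen's relation
      Gabor.IsBessel (Gabor.system g α β) ∧
        ∃ γ : Gabor.L2 d, Gabor.IsDualWindow g γ α β ∧ Gabor.JanssenRelation g γ α β,
      -- the same, with the reconstruction property of the window not demanded
      Gabor.IsBessel (Gabor.system g α β) ∧
        ∃ γ : Gabor.L2 d, Gabor.IsBessel (Gabor.system γ α β) ∧ Gabor.JanssenRelation g γ α β,
      -- the Gabor system over the adjoint lattice is a Riesz sequence
      Gabor.IsRieszSequence (Gabor.system g (1 / β) (1 / α)),
      -- uniform two-sided bounds for the pre-Gramians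
      ∃ A B : ℝ, 0 < A ∧ 0 < B ∧
        ∀ᵐ x : Gabor.Space d, Gabor.TwoSidedBounds (Gabor.preGramian g α β x) A B,
      -- the spectra of the Ron-Shen matrices
      ∃ A B : ℝ, 0 < A ∧ 0 < B ∧
        ∀ᵐ x : Gabor.Space d, Gabor.SpectrumIn (Gabor.ronShen g α β x) A B,
      -- uniformly bounded pre-Gramians with uniformly bounded left inverses
      ∃ (C D : ℝ) (P Γ : Gabor.Space d →
          (Gabor.SeqL2 (Fin d → ℤ) →L[ℂ] Gabor.SeqL2 (Fin d → ℤ))),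
        ∀ᵐ x : Gabor.Space d, Gabor.ActsAs (P x) (Gabor.preGramian g α β x) ∧ ‖P x‖ ≤ D ∧
          Γ x ∘L P x = ContinuousLinearMap.id ℂ _ ∧ ‖Γ x‖ ≤ C] := by
  tfae_have 1 → 2 := by
    intro h
    obtain ⟨γ, hγ⟩ := h.exists_isDualWindow
    exact ⟨h.isBessel, γ, hγ, hγ.janssenRelation hβ h.isBessel⟩
  tfae_have 2 → 3 := by
    rintro ⟨h, γ, hγ, hJ⟩
    exact ⟨h, γ, hγ.1, hJ⟩
  tfae_have 3 → 7 := by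
    rintro ⟨h, γ, hγ, hJ⟩
    obtain ⟨C, D, hCD⟩ := hJ.ae_exists_leftInverse hβ h hγ
    -- The operators are chosen point by point; no measurability in `x` is asked of them.
    choose! P G hPG using fun x (hx : ∃ P G : Gabor.SeqL2 (Fin d → ℤ) →L[ℂ]
      Gabor.SeqL2 (Fin d → ℤ), Gabor.ActsAs P (Gabor.preGramian g α β x) ∧ ‖P‖ ≤ D ∧
        G ∘L P = ContinuousLinearMap.id ℂ _ ∧ ‖G‖ ≤ C) => hx
    exact ⟨C, D, P, G, hCD.mono hPG⟩
  tfae_have 7 → 5 := by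
    rintro ⟨C, D, P, G, h⟩
    -- `C` and `D` carry no sign condition; the maxima with `1` make both bounds positive.
    refine ⟨((max C 1) ^ 2)⁻¹, (max D 1) ^ 2, by positivity, by positivity, h.mono fun x hx => ?_⟩
    exact hx.1.twoSidedBounds_of_leftInverse hx.2.2.1 (by positivity)
      (hx.2.2.2.trans (le_max_left _ _)) (hx.2.1.trans (le_max_left _ _))
  tfae_have 5 → 6 := by
    rintro ⟨A, B, hA, hB, h⟩
    -- `ronShen g α β x` is by definition the `gram` matrix of `preGramian g α β x`.
    exact ⟨A, B, hA, hB, h.mono fun x hx => hx.spectrumIn_gram hA.le hB.le⟩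
  tfae_have 6 → 5 := by
    rintro ⟨A, B, hA, hB, h⟩
    refine ⟨A, B, hA, hB, ?_⟩
    filter_upwards [h, Gabor.ae_summable_preGramian g hα β] with x hx hs
    exact Gabor.SpectrumIn.twoSidedBounds hA.le hB.le hs hx
  tfae_have 5 → 1 := by
    rintro ⟨A, B, hA, hB, h⟩
    exact Gabor.isFrame_of_ae_finiteBounds hβ hA hB
      (h.mono fun x hx => hx.finiteBounds hA.le hB.le)
  tfae_have 5 → 4 := by
    rintro ⟨A, B, hA, hB, h⟩
    exact Gabor.isRieszSequence_of_ae_finiteBounds hα hA hB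
      (h.mono fun x hx => hx.finiteBounds hA.le hB.le)
  tfae_have 4 → 5 := fun h => h.ae_twoSidedBounds hα
  tfae_finish
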